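/- Let $(\Omega,\mathcal F,\mathbb P)$ be a probability space with a filtration $(\mathcal F_i)_{i\ge 0}$, and let $(\xi_i)_{i\ge 1}$ be real martingale differences with respect to it: $\xi_i$ is integrable and $\mathcal F_i$-measurable, and $\mathbb E(\xi_i\mid\mathcal F_{i-1})=0$ a.s. for $i\ge1$. Assume that all $\xi_i$ are in $\mathbb L^p$ for some $p\in(2,3]$. Write $\sigma_i=(\mathbb E\,\xi_i^2)^{1/2}$, $M_n=\sum_{i=1}^n\xi_i$, $V_n=\sum_{i=1}^n\sigma_i^2$, $\delta_n=\max_{1\le i\le n}\sigma_i$, $v_n(1)=\delta_n^2+2V_n$, and $$U_{\ell,n}(p)=\Big\|\,(|\xi_{\ell-1}|\vee\sigma_{\ell-1})^{p-2}\,\Big|\sum_{k=\ell}^n\big(\mathbb E(\xi_k^2\mid\mathcal F_{\ell-1})-\sigma_k^2\big)\Big|\,\Big\|_1\quad(\ell\ge2),$$ $$L_n(p,r,\delta_n)=\sum_{\ell=2}^n\frac{U_{\ell,n}(p)}{(V_n-V_{\ell-1}+\delta_n^2)^{(p-r)/2}},\qquad S_n(p)=\sup_{1\le k\le n}\frac{\mathbb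 E|\xi_k|^p}{\sigma_k^2},$$ where $0/0=0$ in $S_n(p)$. For $V_n>0$ let $\Delta_{n,\infty}=\sup_{x\in\mathbb R}|F_n(x)-\Phi(x)|$, where $F_n$ is the distribution function of $M_n/\sqrt{V_n}$ and $\Phi$ that of the standard normal law. Then there is a constant $C_p>0$ depending only on $p$ such that, for every $n\ge1$ with $V_n>0$, $$\Delta_{n,\infty}\le C_p\,V_n^{-\frac{p-2}{2(p-1)}}\big(S_n(p)+L_n(p,p-2,\delta_n)\big)^{1/(p-1)}\quad\text{if }p\in(2,3),$$ $$\Delta_{n,\infty}\le C_3\,V_n^{-1/4}\Big(S_n(3)\log\big(\sqrt{v_n(1)}/\delta_n\big)+L_n(3,1,\delta_n)\Big)^{1/2}\quad\text{if }p=3.$$ In particular, for every $K$ there is a constant $C_{p,K}>0$ depending only on $p$ and $K$ such that, for every $n\ge1$ with $V_n>0$, $S_n(p)\le K$ and $\mathbb E(\xi_k^2\mid\mathcal F_{k-1})=\sigma_k^2$ a.s. for $1\le k\le n$, $$\Delta_{n,\infty}\le C_{p,K}\,V_n^{-\frac{p-2}{2(p-1)}}\quad\text{if }p\in(2,3),\qquad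 \Delta_{n,\infty}\le C_{3,K}\,V_n^{-1/4}\log^{1/2}\big(\sqrt{v_n(1)}/\delta_n\big)\quad\text{if }p=3.$$ -/

import Mathlib

open MeasureTheory ProbabilityTheory

universe u

noncomputable section

namespace MartingaleCLT

/-- `ξ 1, ξ 2, …` are martingale differences with respect to the filtration `ℱ 0 ⊆ ℱ 1 ⊆ …`:
`ξ k` is integrable and `ℱ k`-measurable, and `E(ξ k | ℱ (k - 1)) = 0` a.s., for every `k ≥ 1`.
(The value `ξ 0` plays no role.) -/
structure IsMartingaleDifference {Ω : Type u} {m : MeasurableSpace Ω} (ξ : ℕ → Ω → ℝ)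
    (ℱ : Filtration ℕ m) (μ : Measure Ω) : Prop where
  measurable : ∀ k, 1 ≤ k → Measurable[ℱ k] (ξ k)
  integrable : ∀ k, 1 ≤ k → Integrable (ξ k) μ
  condExp_eq_zero : ∀ k, 1 ≤ k → μ[ξ k | ℱ (k - 1)] =ᵐ[μ] 0

variable {Ω : Type u} {m : MeasurableSpace Ω}

/-- `σ_k = (E ξ_k²)^{1/2}`. -/
def sigma (ξ : ℕ → Ω → ℝ) (μ : Measure Ω) (k : ℕ) : ℝ :=
  Real.sqrt (∫ ω, ξ k ω ^ 2 ∂μ)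

/-- `M_n = ξ_1 + ⋯ + ξ_n`. -/
def partialSum (ξ : ℕ → Ω → ℝ) (n : ℕ) (ω : Ω) : ℝ :=
  ∑ k ∈ Finset.Icc 1 n, ξ k ω

/-- `V_n = σ_1² + ⋯ + σ_n²`. -/
def V (ξ : ℕ → Ω → ℝ) (μ : Measure Ω) (n : ℕ) : ℝ :=
  ∑ k ∈ Finset.Icc 1 n, sigma ξ μ k ^ 2

/-- `δ_n = max_{1 ≤ k ≤ n} σ_k`. -/
def delta (ξ : ℕ → Ω → ℝ) (μ : Measure Ω) (n : ℕ) : ℝ :=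
  ⨆ k : Finset.Icc 1 n, sigma ξ μ k

/-- `v_n(a) = a² δ_n² + ((1 + a²) / a²) V_n`. -/
def v (ξ : ℕ → Ω → ℝ) (μ : Measure Ω) (n : ℕ) (a : ℝ) : ℝ :=
  a ^ 2 * delta ξ μ n ^ 2 + (1 + a ^ 2) / a ^ 2 * V ξ μ n

/-- `U_{ℓ,n}(p) = ‖ (|ξ_{ℓ-1}| ∨ σ_{ℓ-1})^{p-2} |∑_{k=ℓ}^n (E(ξ_k² | ℱ_{ℓ-1}) - σ_k²)| ‖₁`,
used for `ℓ ≥ 2`. -/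
def U (ξ : ℕ → Ω → ℝ) (ℱ : Filtration ℕ m) (μ : Measure Ω) (n : ℕ) (p : ℝ) (l : ℕ) : ℝ :=
  ∫ ω, max |ξ (l - 1) ω| (sigma ξ μ (l - 1)) ^ (p - 2) *
    |∑ k ∈ Finset.Icc l n,
      ((μ[fun ω' ↦ ξ k ω' ^ 2 | ℱ (l - 1)]) ω - sigma ξ μ k ^ 2)| ∂μ

/-- `L_n(p, r, d) = ∑_{ℓ=2}^n U_{ℓ,n}(p) / (V_n - V_{ℓ-1} + d²)^{(p-r)/2}`. -/
def L (ξ : ℕ → Ω → ℝ) (ℱ : Filtration ℕ m) (μ : Measure Ω) (n : ℕ) (p r d : ℝ) : ℝ :=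
  ∑ l ∈ Finset.Icc 2 n,
    U ξ ℱ μ n p l / (V ξ μ n - V ξ μ (l - 1) + d ^ 2) ^ ((p - r) / 2)

/-- `sup_{1 ≤ k ≤ n} E|ξ_k|^p / σ_k²`. An index `k` with `σ_k = 0`, for which `ξ_k = 0` a.s.,
contributes `0 / 0 = 0`. -/
def momentRatio (ξ : ℕ → Ω → ℝ) (μ : Measure Ω) (n : ℕ) (p : ℝ) : ℝ :=
  ⨆ k : Finset.Icc 1 n, (∫ ω, |ξ k ω| ^ p ∂μ) / sigma ξ μ k ^ 2

/-- `Δ_{n,∞} = sup_x |F_n(x) - Φ(x)|`, where `F_n` is the distribution function of `M_n / √V_n`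
and `Φ` that of the standard normal law. -/
def kolmogorovDist (ξ : ℕ → Ω → ℝ) (μ : Measure Ω) (n : ℕ) : ℝ :=
  ⨆ x : ℝ, |cdf (μ.map fun ω ↦ partialSum ξ n ω / Real.sqrt (V ξ μ n)) x
    - cdf (gaussianReal 0 1) x|

/-- For `k = 1, …, n` the conditional variance of `ξ_k` given `ℱ_{k-1}` is a.s. the constant
`σ_k²`. -/
def ConstCondVar (ξ : ℕ → Ω → ℝ) (ℱ : Filtration ℕ m) (μ : Measure Ω) (n : ℕ) : Prop :=
  ∀ k ∈ Finset.Icc 1 n,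
    μ[fun ω ↦ ξ k ω ^ 2 | ℱ (k - 1)] =ᵐ[μ] fun _ ↦ sigma ξ μ k ^ 2

end MartingaleCLT

end

/-! The proof is Lindeberg's method with Gaussian smoothing. Write `heat s` for the distribution
function of N(0, s) and s_k = V_n - V_k + ε². The path E `heat` s_k (x - M_k) runs from N(0, V_n +
ε²) at k = 0 to the law of M_n smoothed by N(0, ε²) at k = n. In one step the first order term
vanishes by the martingale property. The Taylor remainder is O(E|ξ_{k+1}|^p / s_{k+1}^{p/2}),
because `heat'' s` is (p-2)-Hölder, and a term in ξ_{k+1}² - σ_{k+1}² is left over.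

The left-over terms do not vanish individually, since the conditional variances are random. Abel
summation moves the difference onto `heat''`. The tail sums of ξ_k² - σ_k² can then be conditioned
on the past, and the increment of `heat''` produces the weight (|ξ| ∨ σ)^{p-2}; this is `U`. The
result is `abs_integral_heat_sub_le`.

The sum of remainders is O(S ε^{2-p}) by `sum_div_rpow_le`, valid also at p = 3, and the other error
is O(L ε^{2-p}) once ε ≥ δ_n. Removing the smoothing costs O(ε / √V_n) by `iSup_abs_cdf_sub_le`.
Equating the two errors gives ε^{p-1} = (S + L) √V_n, hence the rate. This choice satisfies ε ≥ δ_n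
because δ_n^{p-2} ≤ S and δ_n ≤ √V_n.

No logarithm arises at p = 3. The stated logarithmic factor is at least 1/2, so that form is weaker
up to a constant. If the conditional variances are constant, the tower property gives L = 0. -/

noncomputable section

namespace MartingaleCLT

/-! ### The standard normal law: derivatives and uniform bounds. -/

/-- The standard normal density. -/
def stdPDF (x : ℝ) : ℝ := (Real.sqrt (2 * Real.pi))⁻¹ * Real.exp (-x ^ 2 / 2)

/-- The standard normal distribution function. -/
def stdCDF (x : ℝ) : ℝ := cdf (gaussianReal 0 1) x

/-- The derivative of the standard normal density. -/
def stdPDF' (x : ℝ) : ℝ := -x * stdPDF x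

lemma gaussianPDFReal_zero_one (x : ℝ) : gaussianPDFReal 0 1 x = stdPDF x := by
  simp [gaussianPDFReal, stdPDF]

lemma continuous_stdPDF : Continuous stdPDF := by
  unfold stdPDF; fun_prop

lemma continuous_stdPDF' : Continuous stdPDF' := by
  unfold stdPDF'
  exact continuous_neg.mul continuous_stdPDF

lemma integrable_stdPDF : Integrable stdPDF := by
  have := integrable_gaussianPDFReal 0 1
  simpa only [funext gaussianPDFReal_zero_one] using this

lemma stdCDF_eq (x : ℝ) : stdCDF x = ∫ t in Set.Iic x, stdPDF t := by
  rw [stdCDF, cdf_eq_real, measureReal_def, gaussianReal_apply_eq_integral 0 one_ne_zero,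
    ENNReal.toReal_ofReal]
  · simp only [gaussianPDFReal_zero_one]
  · exact setIntegral_nonneg measurableSet_Iic fun t _ ↦ gaussianPDFReal_nonneg 0 1 t

lemma hasDerivAt_stdCDF (x : ℝ) : HasDerivAt stdCDF (stdPDF x) x := by
  have h : stdCDF = fun y ↦ (∫ t in (0 : ℝ)..y, stdPDF t) + stdCDF 0 := by
    funext y
    rw [stdCDF_eq, stdCDF_eq, ← intervalIntegral.integral_Iic_sub_Iic
      integrable_stdPDF.integrableOn integrable_stdPDF.integrableOn]
    ring
  rw [h]
  exact (intervalIntegral.integral_hasDerivAt_right integrable_stdPDF.intervalIntegrable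
    (continuous_stdPDF.stronglyMeasurableAtFilter _ _) continuous_stdPDF.continuousAt).add_const _

lemma hasDerivAt_stdPDF (x : ℝ) : HasDerivAt stdPDF (stdPDF' x) x := by
  unfold stdPDF stdPDF' stdPDF
  have h : HasDerivAt (fun y : ℝ ↦ -y ^ 2 / 2) (-x) x := by
    exact ((hasDerivAt_pow 2 x).fun_neg.div_const 2).congr_deriv (by simp; ring)
  exact (h.exp.const_mul (Real.sqrt (2 * Real.pi))⁻¹).congr_deriv (by ring)

lemma hasDerivAt_stdPDF' (x : ℝ) : HasDerivAt stdPDF' ((x ^ 2 - 1) * stdPDF x) x := by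
  have := (hasDerivAt_neg x).mul (hasDerivAt_stdPDF x)
  refine (this.congr_deriv ?_)
  unfold stdPDF'
  ring

lemma stdPDF_nonneg (x : ℝ) : 0 ≤ stdPDF x := by unfold stdPDF; positivity

/-- A bound for a function against the Gaussian density. -/
lemma mul_stdPDF_le {c y x : ℝ} (hy : 0 ≤ y) (hc : 0 ≤ c)
    (h : y ≤ c * (1 + x ^ 2 / 2 + (x ^ 2 / 2) ^ 2 / 2)) : y * stdPDF x ≤ c := by
  have h1 : (Real.sqrt (2 * Real.pi))⁻¹ ≤ 1 := by
    apply inv_le_one_of_one_le₀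
    rw [Real.one_le_sqrt]
    nlinarith [Real.pi_gt_three]
  have h2 := Real.quadratic_le_exp_of_nonneg (x := x ^ 2 / 2) (by positivity)
  have h3 : y ≤ c * Real.exp (x ^ 2 / 2) := h.trans (by gcongr)
  have h4 : y * Real.exp (-x ^ 2 / 2) ≤ c := by
    rw [show -x ^ 2 / 2 = -(x ^ 2 / 2) by ring, Real.exp_neg]
    rwa [← div_eq_mul_inv, div_le_iff₀ (Real.exp_pos _)]
  calc y * stdPDF x = (Real.sqrt (2 * Real.pi))⁻¹ * (y * Real.exp (-x ^ 2 / 2)) := by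
        unfold stdPDF; ring
    _ ≤ 1 * c := by gcongr
    _ = c := one_mul c

lemma stdPDF_le_one (x : ℝ) : stdPDF x ≤ 1 := by
  have := mul_stdPDF_le (c := 1) (y := 1) (x := x) zero_le_one zero_le_one
    (by nlinarith [sq_nonneg x, sq_nonneg (x ^ 2)])
  simpa using this

lemma abs_stdPDF'_le (x : ℝ) : |stdPDF' x| ≤ 1 := by
  rw [stdPDF', abs_mul, abs_neg, abs_of_nonneg (stdPDF_nonneg x)]
  refine mul_stdPDF_le (abs_nonneg x) zero_le_one ?_
  nlinarith [sq_abs x, sq_nonneg (|x| - 1), sq_nonneg (x ^ 2)]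

lemma abs_deriv_stdPDF'_le (x : ℝ) : |(x ^ 2 - 1) * stdPDF x| ≤ 3 := by
  rw [abs_mul, abs_of_nonneg (stdPDF_nonneg x)]
  refine mul_stdPDF_le (abs_nonneg _) (by norm_num) ?_
  rw [abs_le]
  constructor <;> nlinarith [sq_nonneg x, sq_nonneg (x ^ 2)]

lemma abs_mul_deriv_stdPDF'_le (x : ℝ) : |x * ((x ^ 2 - 1) * stdPDF x)| ≤ 9 := by
  rw [← mul_assoc, abs_mul, abs_of_nonneg (stdPDF_nonneg x)]
  refine mul_stdPDF_le (abs_nonneg _) (by norm_num) ?_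
  rw [abs_le]
  constructor <;> nlinarith [sq_nonneg x, sq_nonneg (x ^ 2), sq_nonneg (x ^ 2 - x),
    sq_nonneg (x ^ 2 + x), sq_nonneg (x - 1), sq_nonneg (x + 1)]

lemma abs_sub_le_of_hasDerivAt {f f' : ℝ → ℝ} {C x y : ℝ}
    (h : ∀ t ∈ Set.uIcc x y, HasDerivAt f (f' t) t) (hC : ∀ t ∈ Set.uIcc x y, |f' t| ≤ C) :
    |f y - f x| ≤ C * |y - x| := by
  have := Convex.norm_image_sub_le_of_norm_hasDerivWithin_le (f := f) (f' := f') (C := C)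
    (s := Set.uIcc x y) (x := x) (y := y) (fun t ht ↦ (h t ht).hasDerivWithinAt)
    (fun t ht ↦ by simpa using hC t ht) (convex_uIcc x y) Set.left_mem_uIcc Set.right_mem_uIcc
  simpa using this

lemma abs_stdCDF_sub_le (x y : ℝ) : |stdCDF y - stdCDF x| ≤ |y - x| := by
  have := abs_sub_le_of_hasDerivAt (x := x) (y := y) (C := 1) (fun t _ ↦ hasDerivAt_stdCDF t)
    (fun t _ ↦ by rw [abs_of_nonneg (stdPDF_nonneg t)]; exact stdPDF_le_one t)
  simpa using this

lemma abs_stdPDF'_sub_le (x y : ℝ) : |stdPDF' y - stdPDF' x| ≤ 3 * |y - x| :=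
  abs_sub_le_of_hasDerivAt (fun t _ ↦ hasDerivAt_stdPDF' t) (fun t _ ↦ abs_deriv_stdPDF'_le t)

/-- Interpolation between a constant and a linear bound. -/
lemma le_mul_rpow_of_le_of_le {z a C θ : ℝ} (ha : 0 ≤ a) (hC : 0 ≤ C) (hθ0 : 0 ≤ θ) (hθ1 : θ ≤ 1)
    (h1 : z ≤ C) (h2 : z ≤ C * a) : z ≤ C * a ^ θ := by
  rcases le_total a 1 with h | h
  · rcases ha.eq_or_lt with rfl | ha'
    · exact h2.trans (by simp; positivity)
    · refine h2.trans ?_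
      gcongr
      calc a = a ^ (1 : ℝ) := (Real.rpow_one a).symm
        _ ≤ a ^ θ := Real.rpow_le_rpow_of_exponent_ge ha' h hθ1
  · refine h1.trans ?_
    exact le_mul_of_one_le_right hC (Real.one_le_rpow h hθ0)

/-! ### Expansions of Gaussian distribution functions in position and variance. -/

/-- The distribution function at `x` of the centred normal law with variance `s`. -/
def heat (s x : ℝ) : ℝ := stdCDF (x / Real.sqrt s)

/-- The first derivative of `heat s`. -/
def heat' (s x : ℝ) : ℝ := stdPDF (x / Real.sqrt s) / Real.sqrt s

/-- The second derivative of `heat s`. -/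
def heat'' (s x : ℝ) : ℝ := stdPDF' (x / Real.sqrt s) / s

lemma hasDerivAt_heat (s x : ℝ) : HasDerivAt (heat s) (heat' s x) x := by
  have h := (hasDerivAt_stdCDF (x / Real.sqrt s)).comp x ((hasDerivAt_id x).div_const (Real.sqrt s))
  refine h.congr_deriv ?_
  simp [heat', div_eq_mul_inv]

lemma hasDerivAt_heat' {s : ℝ} (hs : 0 ≤ s) (x : ℝ) : HasDerivAt (heat' s) (heat'' s x) x := by
  have h := ((hasDerivAt_stdPDF (x / Real.sqrt s)).comp x
    ((hasDerivAt_id x).div_const (Real.sqrt s))).div_const (Real.sqrt s)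
  refine h.congr_deriv ?_
  rw [heat'', mul_div_assoc, div_div, Real.mul_self_sqrt hs]
  ring

lemma hasDerivAt_div_sqrt {s : ℝ} (hs : 0 < s) (x : ℝ) :
    HasDerivAt (fun s ↦ x / Real.sqrt s) (-(x / Real.sqrt s) / (2 * s)) s := by
  have h0 : Real.sqrt s ≠ 0 := (Real.sqrt_pos.2 hs).ne'
  have h := (hasDerivAt_const s x).fun_div (Real.hasDerivAt_sqrt hs.ne') h0
  refine h.congr_deriv ?_
  have h1 : Real.sqrt s ^ 2 = s := Real.sq_sqrt hs.le
  rw [← h1]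
  rw [Real.sqrt_sq (Real.sqrt_nonneg s)]
  field_simp
  ring

/-- The heat equation: it lets added variance compensate the second order effect of a random
displacement. -/
lemma hasDerivAt_heat_variance {s : ℝ} (hs : 0 < s) (x : ℝ) :
    HasDerivAt (fun s ↦ heat s x) (heat'' s x / 2) s := by
  have h := (hasDerivAt_stdCDF (x / Real.sqrt s)).comp s (hasDerivAt_div_sqrt hs x)
  refine h.congr_deriv ?_
  rw [heat'', stdPDF']
  field_simp

lemma hasDerivAt_heat''_variance {s : ℝ} (hs : 0 < s) (x : ℝ) :
    HasDerivAt (fun s ↦ heat'' s x)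
      (-(stdPDF' (x / Real.sqrt s) + x / Real.sqrt s *
        (((x / Real.sqrt s) ^ 2 - 1) * stdPDF (x / Real.sqrt s)) / 2) / s ^ 2) s := by
  have h := ((hasDerivAt_stdPDF' (x / Real.sqrt s)).comp s (hasDerivAt_div_sqrt hs x)).fun_div
    (hasDerivAt_id s) hs.ne'
  refine h.congr_deriv ?_
  simp only [Function.comp, id]
  field_simp
  ring

lemma abs_heat''_le {s : ℝ} (hs : 0 < s) (x : ℝ) : |heat'' s x| ≤ 1 / s := by
  rw [heat'', abs_div, abs_of_pos hs]
  gcongr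
  exact abs_stdPDF'_le _

lemma rpow_div_sqrt {p s a : ℝ} (hs : 0 < s) (ha : 0 ≤ a) :
    (a / Real.sqrt s) ^ (p - 2) / s = a ^ (p - 2) / s ^ (p / 2) := by
  rw [Real.div_rpow ha (Real.sqrt_nonneg s), Real.sqrt_eq_rpow, ← Real.rpow_mul hs.le, div_div]
  congr 1
  nth_rewrite 2 [← Real.rpow_one s]
  rw [← Real.rpow_add hs]
  congr 1
  ring

/-- `stdPDF'` is bounded and Lipschitz, hence Hölder of exponent p - 2 ∈ [0, 1]; rescaling by √s
gives the power of s. -/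
lemma abs_heat''_sub_le {p s : ℝ} (hp2 : 2 ≤ p) (hp3 : p ≤ 3) (hs : 0 < s) (x y : ℝ) :
    |heat'' s y - heat'' s x| ≤ 3 * (|y - x| ^ (p - 2) / s ^ (p / 2)) := by
  have h : |stdPDF' (y / Real.sqrt s) - stdPDF' (x / Real.sqrt s)|
      ≤ 3 * (|y - x| / Real.sqrt s) ^ (p - 2) := by
    refine le_mul_rpow_of_le_of_le (by positivity) (by norm_num) (by linarith) (by linarith) ?_ ?_
    · refine (abs_sub _ _).trans ?_
      linarith [abs_stdPDF'_le (y / Real.sqrt s), abs_stdPDF'_le (x / Real.sqrt s)]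
    · refine (abs_stdPDF'_sub_le _ _).trans_eq ?_
      rw [← sub_div, abs_div, abs_of_nonneg (Real.sqrt_nonneg s)]
  rw [← rpow_div_sqrt hs (abs_nonneg _), heat'', heat'', ← sub_div, abs_div, abs_of_pos hs,
    ← mul_div_assoc]
  gcongr

/-- The same interpolation in the variable σ² / s with exponent (p - 2) / 2: variance scales as the
square of length, so σ enters with the same power as a displacement does. -/
lemma abs_heat''_variance_sub_le {p s σ : ℝ} (hp2 : 2 ≤ p) (hp3 : p ≤ 3) (hs : 0 < s)
    (hσ : 0 ≤ σ) (x : ℝ) :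
    |heat'' (s + σ ^ 2) x - heat'' s x| ≤ 6 * (σ ^ (p - 2) / s ^ (p / 2)) := by
  have hσs : 0 < s + σ ^ 2 := by positivity
  have h : s * |heat'' (s + σ ^ 2) x - heat'' s x| ≤ 6 * ((σ / Real.sqrt s) ^ 2) ^ ((p - 2) / 2) := by
    refine le_mul_rpow_of_le_of_le (by positivity) (by norm_num) (by linarith) (by linarith) ?_ ?_
    · have h1 := abs_heat''_le hs x
      have h2 := abs_heat''_le hσs x
      have h3 : 1 / (s + σ ^ 2) ≤ 1 / s := by gcongr; nlinarith
      have h4 : |heat'' (s + σ ^ 2) x - heat'' s x| ≤ 2 * (1 / s) := (abs_sub _ _).trans (by linarith)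
      calc s * |heat'' (s + σ ^ 2) x - heat'' s x| ≤ s * (2 * (1 / s)) := by gcongr
        _ = 2 := by field_simp
        _ ≤ 6 := by norm_num
    · have h1 : |heat'' (s + σ ^ 2) x - heat'' s x| ≤ 6 / s ^ 2 * |s + σ ^ 2 - s| := by
        have hle : ∀ t ∈ Set.uIcc s (s + σ ^ 2), s ≤ t := by
          intro t ht
          rw [Set.uIcc_of_le (by nlinarith)] at ht
          exact ht.1
        refine abs_sub_le_of_hasDerivAt (f := fun s ↦ heat'' s x)
          (fun t ht ↦ hasDerivAt_heat''_variance (hs.trans_le (hle t ht)) x) fun t ht ↦ ?_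
        have ht := hle t ht
        rw [abs_div, abs_neg, abs_of_nonneg (sq_nonneg t)]
        gcongr
        have h2 := abs_stdPDF'_le (x / Real.sqrt t)
        have h3 := abs_mul_deriv_stdPDF'_le (x / Real.sqrt t)
        refine (abs_add_le _ _).trans ?_
        rw [abs_div, abs_two]
        linarith
      rw [add_sub_cancel_left, abs_of_nonneg (sq_nonneg σ)] at h1
      calc s * |heat'' (s + σ ^ 2) x - heat'' s x| ≤ s * (6 / s ^ 2 * σ ^ 2) := by gcongr
        _ = 6 * (σ / Real.sqrt s) ^ 2 := by
          rw [div_pow, Real.sq_sqrt hs.le]; field_simp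
  have hr : ((σ / Real.sqrt s) ^ 2) ^ ((p - 2) / 2) = (σ / Real.sqrt s) ^ (p - 2) := by
    rw [← Real.rpow_natCast, ← Real.rpow_mul (by positivity)]
    congr 1; push_cast; ring
  rw [hr] at h
  rw [← rpow_div_sqrt hs hσ, ← mul_div_assoc, le_div_iff₀ hs, mul_comm]
  exact h

/-- Second order Taylor expansion of the Gaussian distribution function, with a remainder of
order `p ∈ [2, 3]`. -/
lemma abs_heat_taylor_le {p s : ℝ} (hp2 : 2 ≤ p) (hp3 : p ≤ 3) (hs : 0 < s) (a z : ℝ) :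
    |heat s (a + z) - heat s a - heat' s a * z - heat'' s a * z ^ 2 / 2|
      ≤ 3 * (|z| ^ p / s ^ (p / 2)) := by
  have hle : ∀ {t w : ℝ}, t ∈ Set.uIcc 0 w → |t| ≤ |w| := by
    intro t w ht
    have := Set.abs_sub_left_of_mem_uIcc ht
    simpa using this
  have hpow : ∀ w : ℝ, ∀ q : ℝ, 0 ≤ q → |w| ^ q * |w| = |w| ^ (q + 1) := fun w q hq ↦ by
    rw [Real.rpow_add_of_nonneg (abs_nonneg w) hq zero_le_one, Real.rpow_one]
  -- The Hölder bound on `heat''` is integrated twice from 0, each time using the largest value of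
  -- the bound, so the constant 3 does not change.
  have h1 : ∀ w, |heat' s (a + w) - heat' s a - heat'' s a * w|
      ≤ 3 * (|w| ^ (p - 1) / s ^ (p / 2)) := by
    intro w
    have := abs_sub_le_of_hasDerivAt (f := fun w ↦ heat' s (a + w) - heat'' s a * w)
      (f' := fun w ↦ heat'' s (a + w) - heat'' s a)
      (x := 0) (y := w) (C := 3 * (|w| ^ (p - 2) / s ^ (p / 2)))
      (fun t _ ↦ (((hasDerivAt_heat' hs.le (a + t)).comp_const_add a t).sub
        ((hasDerivAt_id t).const_mul (heat'' s a))).congr_deriv (by simp))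
      (fun t ht ↦ by
        refine (abs_heat''_sub_le hp2 hp3 hs _ _).trans ?_
        have := hle ht
        rw [add_sub_cancel_left]
        have : |t| ^ (p - 2) ≤ |w| ^ (p - 2) :=
          Real.rpow_le_rpow (abs_nonneg _) this (by linarith)
        gcongr)
    have h2 : (3 * (|w| ^ (p - 2) / s ^ (p / 2))) * |w| = 3 * (|w| ^ (p - 1) / s ^ (p / 2)) := by
      rw [show p - 1 = p - 2 + 1 by ring, ← hpow w (p - 2) (by linarith)]; ring
    simp only [sub_zero, add_zero, mul_zero] at this
    rw [h2] at this
    convert this using 2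
    ring
  have := abs_sub_le_of_hasDerivAt
    (f := fun w ↦ heat s (a + w) - heat' s a * w - heat'' s a * w ^ 2 / 2)
    (f' := fun w ↦ heat' s (a + w) - heat' s a - heat'' s a * w)
    (x := 0) (y := z) (C := 3 * (|z| ^ (p - 1) / s ^ (p / 2)))
    (fun t _ ↦ ((((hasDerivAt_heat s (a + t)).comp_const_add a t).sub
      ((hasDerivAt_id t).const_mul (heat' s a))).sub
      (((hasDerivAt_pow 2 t).const_mul (heat'' s a)).div_const 2)).congr_deriv (by simp; ring))
    (fun t ht ↦ by
      refine (h1 t).trans ?_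
      have : |t| ^ (p - 1) ≤ |z| ^ (p - 1) :=
        Real.rpow_le_rpow (abs_nonneg _) (hle ht) (by linarith)
      gcongr)
  have h2 : (3 * (|z| ^ (p - 1) / s ^ (p / 2))) * |z| = 3 * (|z| ^ p / s ^ (p / 2)) := by
    nth_rewrite 3 [show p = p - 1 + 1 by ring]
    rw [← hpow z (p - 1) (by linarith)]; ring
  simp only [sub_zero, add_zero, mul_zero] at this
  rw [h2] at this
  convert this using 2
  ring

/-- First order expansion of the Gaussian distribution function in the variance. -/
lemma abs_heat_variance_taylor_le {p s σ : ℝ} (hp2 : 2 ≤ p) (hp3 : p ≤ 3) (hs : 0 < s)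
    (hσ : 0 ≤ σ) (a : ℝ) :
    |heat (s + σ ^ 2) a - heat s a - heat'' s a * σ ^ 2 / 2| ≤ 3 * (σ ^ p / s ^ (p / 2)) := by
  have := abs_sub_le_of_hasDerivAt
    (f := fun w ↦ heat (s + w) a - heat'' s a * w / 2)
    (f' := fun w ↦ heat'' (s + w) a / 2 - heat'' s a / 2)
    (x := 0) (y := σ ^ 2) (C := 3 * (σ ^ (p - 2) / s ^ (p / 2)))
    (fun t ht ↦ by
      rw [Set.uIcc_of_le (sq_nonneg σ)] at ht
      have hst : 0 < s + t := by linarith [ht.1]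
      exact (((hasDerivAt_heat_variance hst a).comp_const_add s t).sub
        (((hasDerivAt_id t).const_mul (heat'' s a)).div_const 2)).congr_deriv (by simp))
    (fun t ht ↦ by
      rw [Set.uIcc_of_le (sq_nonneg σ)] at ht
      have h1 := abs_heat''_variance_sub_le hp2 hp3 hs (Real.sqrt_nonneg t) a
      rw [Real.sq_sqrt ht.1] at h1
      have h2 : Real.sqrt t ^ (p - 2) ≤ σ ^ (p - 2) :=
        Real.rpow_le_rpow (Real.sqrt_nonneg _) ((Real.sqrt_le_left hσ).2 ht.2) (by linarith)
      rw [← sub_div, abs_div, abs_two]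
      have h3 : 6 * (Real.sqrt t ^ (p - 2) / s ^ (p / 2)) ≤ 6 * (σ ^ (p - 2) / s ^ (p / 2)) := by
        gcongr
      linarith)
  have h2 : (3 * (σ ^ (p - 2) / s ^ (p / 2))) * |σ ^ 2| = 3 * (σ ^ p / s ^ (p / 2)) := by
    nth_rewrite 3 [show p = p - 2 + (2 : ℕ) by push_cast; ring]
    rw [Real.rpow_add_of_nonneg hσ (by linarith) (by norm_num), Real.rpow_natCast, abs_sq]; ring
  simp only [sub_zero, add_zero, mul_zero, zero_div] at this
  rw [h2] at this
  convert this using 2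
  ring

lemma rpow_mul_sq_le {p a b : ℝ} (hp2 : 2 ≤ p) (ha : 0 ≤ a) (hb : 0 ≤ b) :
    a ^ (p - 2) * b ^ 2 ≤ a ^ p + b ^ p := by
  have h2 : ∀ c : ℝ, 0 ≤ c → c ^ (p - 2) * c ^ 2 = c ^ p := fun c hc ↦ by
    rw [← Real.rpow_natCast, ← Real.rpow_add_of_nonneg hc (by linarith) (by norm_num)]
    congr 1; push_cast; ring
  have hap : 0 ≤ a ^ p := by positivity
  have hbp : 0 ≤ b ^ p := by positivity
  rcases le_total a b with h | h
  · have : a ^ (p - 2) * b ^ 2 ≤ b ^ (p - 2) * b ^ 2 := by gcongr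
    linarith [h2 b hb]
  · have : a ^ (p - 2) * b ^ 2 ≤ a ^ (p - 2) * a ^ 2 := by gcongr
    linarith [h2 a ha]

/-- One Lindeberg step: a displacement `-z` is traded for an additional variance `σ ^ 2`. -/
lemma abs_heat_exchange_le {p s σ : ℝ} (hp2 : 2 ≤ p) (hp3 : p ≤ 3) (hs : 0 < s) (hσ : 0 ≤ σ)
    (a z : ℝ) :
    |heat s (a - z) - heat (s + σ ^ 2) a + heat' s a * z
        - heat'' (s + σ ^ 2) a * (z ^ 2 - σ ^ 2) / 2|
      ≤ 9 * ((|z| ^ p + σ ^ p) / s ^ (p / 2)) := by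
  -- Both expansions involve `heat'' s`. It is replaced by `heat'' (s + σ ^ 2)`, so that position
  -- and variance later belong to the same time index. The errors add up to 6|z|^p + 9σ^p.
  have h1 := abs_heat_taylor_le hp2 hp3 hs a (-z)
  have h2 := abs_heat_variance_taylor_le hp2 hp3 hs hσ a
  have h3 := abs_heat''_variance_sub_le hp2 hp3 hs hσ a
  have h4 : |(heat'' (s + σ ^ 2) a - heat'' s a) * (z ^ 2 - σ ^ 2)| ≤
      6 * ((|z| ^ p + 2 * σ ^ p) / s ^ (p / 2)) := by
    rw [abs_mul]
    have h5 : |z ^ 2 - σ ^ 2| ≤ |z| ^ 2 + σ ^ 2 := by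
      rw [sq_abs, abs_le]; constructor <;> nlinarith
    calc _ ≤ 6 * (σ ^ (p - 2) / s ^ (p / 2)) * (|z| ^ 2 + σ ^ 2) := by gcongr
      _ = 6 * ((σ ^ (p - 2) * |z| ^ 2 + σ ^ (p - 2) * σ ^ 2) / s ^ (p / 2)) := by ring
      _ ≤ 6 * ((|z| ^ p + 2 * σ ^ p) / s ^ (p / 2)) := by
        have h6 := rpow_mul_sq_le hp2 hσ (abs_nonneg z)
        have h7 : σ ^ (p - 2) * σ ^ 2 = σ ^ p := by
          rw [← Real.rpow_natCast, ← Real.rpow_add_of_nonneg hσ (by linarith) (by norm_num)]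
          congr 1; push_cast; ring
        gcongr 6 * (?_ / _)
        linarith
  rw [abs_neg] at h1
  have hz : 0 ≤ |z| ^ p / s ^ (p / 2) := by positivity
  have hss : 0 ≤ σ ^ p / s ^ (p / 2) := by positivity
  rw [add_div, mul_div_assoc] at h4
  rw [add_div]
  rw [abs_le] at h1 h2 h4 ⊢
  rw [← sub_eq_add_neg] at h1
  constructor <;> nlinarith

/-! ### Removing a Gaussian smoothing from the Kolmogorov distance. -/

lemma integral_sq_gaussianReal : ∫ t, t ^ 2 ∂gaussianReal 0 1 = 1 := by
  have h := variance_fun_id_gaussianReal (μ := 0) (v := 1)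
  rw [variance_eq_sub (X := fun x : ℝ ↦ x) (memLp_id_gaussianReal 2)] at h
  simpa using h

lemma integrable_sq_gaussianReal : Integrable (fun t : ℝ ↦ t ^ 2) (gaussianReal 0 1) :=
  (memLp_id_gaussianReal 2).integrable_sq

lemma stdCDF_mem_Icc (x : ℝ) : stdCDF x ∈ Set.Icc (0 : ℝ) 1 :=
  ⟨cdf_nonneg _ x, cdf_le_one _ x⟩

lemma continuous_stdCDF : Continuous stdCDF :=
  continuous_iff_continuousAt.2 fun x ↦ (hasDerivAt_stdCDF x).continuousAt

/-- Both sides are P(Z + εN ≤ x) for independent Z ~ ν and N standard normal; the identity is Fubini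
for the indicator of this event. -/
lemma integral_cdf_sub_mul (ν : Measure ℝ) [IsProbabilityMeasure ν] {ε : ℝ} (hε : 0 < ε) (x : ℝ) :
    ∫ t, cdf ν (x - ε * t) ∂gaussianReal 0 1 = ∫ z, stdCDF ((x - z) / ε) ∂ν := by
  let s : Set (ℝ × ℝ) := {q | q.2 ≤ x - ε * q.1}
  have hs : MeasurableSet s := measurableSet_le measurable_snd (by fun_prop)
  have h1 : ∀ t, cdf ν (x - ε * t) = ∫ z, s.indicator (fun _ ↦ (1 : ℝ)) (t, z) ∂ν := fun t ↦ by
    have : (fun z ↦ s.indicator (fun _ ↦ (1 : ℝ)) (t, z))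
        = (Set.Iic (x - ε * t)).indicator (fun _ ↦ 1) := by
      ext z; simp [Set.indicator, s]
    rw [this, integral_indicator_const _ measurableSet_Iic, cdf_eq_real]
    simp
  have h2 : ∀ z, stdCDF ((x - z) / ε)
      = ∫ t, s.indicator (fun _ ↦ (1 : ℝ)) (t, z) ∂gaussianReal 0 1 := fun z ↦ by
    have : (fun t ↦ s.indicator (fun _ ↦ (1 : ℝ)) (t, z))
        = (Set.Iic ((x - z) / ε)).indicator (fun _ ↦ 1) := by
      ext t
      have : z ≤ x - ε * t ↔ t ≤ (x - z) / ε := by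
        rw [le_div_iff₀ hε]; constructor <;> intro h <;> linarith
      simp [Set.indicator, s, this]
    rw [this, integral_indicator_const _ measurableSet_Iic, stdCDF, cdf_eq_real]
    simp
  simp_rw [h1, h2]
  refine integral_integral_swap ?_
  exact (integrable_const (1 : ℝ)).indicator hs

/-- A smoothing inequality: closeness of `ν` smoothed by a centred normal law with standard
deviation `ε` to the standard normal law controls the Kolmogorov distance. -/
theorem iSup_abs_cdf_sub_le (ν : Measure ℝ) [IsProbabilityMeasure ν] {ε R : ℝ} (hε : 0 < ε)
    (h : ∀ x, |∫ z, stdCDF ((x - z) / ε) ∂ν - stdCDF x| ≤ R) :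
    ⨆ x, |cdf ν x - stdCDF x| ≤ 2 * R + 10 * ε := by
  set Δ : ℝ → ℝ := fun x ↦ cdf ν x - stdCDF x with hΔ
  set D : ℝ := ⨆ x, |Δ x| with hD
  have hΔ1 : ∀ x, |Δ x| ≤ 1 := fun x ↦ by
    have h1 := stdCDF_mem_Icc x
    have h2 := cdf_nonneg ν x
    have h3 := cdf_le_one ν x
    simp only [hΔ]
    rw [abs_le]; constructor <;> linarith [h1.1, h1.2]
  have hΔD : ∀ x, |Δ x| ≤ D := le_ciSup (f := fun x ↦ |Δ x|)
    ⟨1, by rintro _ ⟨x, rfl⟩; exact hΔ1 x⟩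
  have hmΔ : Measurable Δ := ((monotone_cdf ν).measurable).sub continuous_stdCDF.measurable
  have hint : ∀ x, Integrable (fun t ↦ Δ (x - ε * t)) (gaussianReal 0 1) := fun x ↦
    Integrable.of_bound (hmΔ.comp (by fun_prop)).aestronglyMeasurable 1
      (Filter.Eventually.of_forall fun t ↦ hΔ1 _)
  have hintΦ : ∀ x, Integrable (fun t ↦ stdCDF (x - ε * t)) (gaussianReal 0 1) := fun x ↦
    Integrable.of_bound (continuous_stdCDF.measurable.comp (by fun_prop)).aestronglyMeasurable 1
      (Filter.Eventually.of_forall fun t ↦ by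
        have := stdCDF_mem_Icc (x - ε * t)
        rw [Real.norm_eq_abs, abs_of_nonneg this.1]; exact this.2)
  have hintF : ∀ x, Integrable (fun t ↦ cdf ν (x - ε * t)) (gaussianReal 0 1) := fun x ↦ by
    refine ((hint x).add (hintΦ x)).congr (Filter.Eventually.of_forall fun t ↦ ?_)
    simp [hΔ]
  have hsq := integrable_sq_gaussianReal
  have hΦ : ∀ x, |∫ t, stdCDF (x - ε * t) ∂gaussianReal 0 1 - stdCDF x| ≤ ε := fun x ↦ by
    have h1 : ∫ t, stdCDF (x - ε * t) ∂gaussianReal 0 1 - stdCDF x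
        = ∫ t, (stdCDF (x - ε * t) - stdCDF x) ∂gaussianReal 0 1 := by
      rw [integral_sub (hintΦ x) (integrable_const _)]; simp
    rw [h1]
    refine abs_integral_le_integral_abs.trans ?_
    have h2 : ∫ t : ℝ, ε * ((1 + t ^ 2) / 2) ∂gaussianReal 0 1 = ε := by
      rw [integral_const_mul, integral_div, integral_add (integrable_const _) hsq,
        integral_sq_gaussianReal]
      simp
    conv_rhs => rw [← h2]
    refine integral_mono ((hintΦ x).sub (integrable_const _)).abs
      ((((integrable_const _).add hsq).div_const 2).const_mul ε) fun t ↦ ?_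
    refine (abs_stdCDF_sub_le x (x - ε * t)).trans ?_
    have h3 : |x - ε * t - x| = ε * |t| := by
      rw [show x - ε * t - x = -(ε * t) by ring, abs_neg, abs_mul, abs_of_pos hε]
    rw [h3]
    have : |t| ≤ (1 + t ^ 2) / 2 := by nlinarith [sq_abs t, sq_nonneg (|t| - 1)]
    gcongr
  have hsm : ∀ x, |∫ t, Δ (x - ε * t) ∂gaussianReal 0 1| ≤ R + ε := fun x ↦ by
    have h1 : ∫ t, Δ (x - ε * t) ∂gaussianReal 0 1
        = ∫ z, stdCDF ((x - z) / ε) ∂ν - ∫ t, stdCDF (x - ε * t) ∂gaussianReal 0 1 := by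
      rw [← integral_cdf_sub_mul ν hε x, ← integral_sub (hintF x) (hintΦ x)]
    have h2 := h x
    have h3 := hΦ x
    rw [h1]
    rw [abs_le] at h2 h3 ⊢
    constructor <;> linarith
  have hquad : ∀ c d : ℝ, ∫ t : ℝ, (c + d * (t ^ 2 / 4)) ∂gaussianReal 0 1 = c + d / 4 :=
    fun c d ↦ by
      rw [integral_add (integrable_const _) ((hsq.div_const 4).const_mul d), integral_const_mul,
        integral_div, integral_sq_gaussianReal]
      simp; ring
  have hquadi : ∀ c d : ℝ, Integrable (fun t : ℝ ↦ c + d * (t ^ 2 / 4)) (gaussianReal 0 1) :=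
    fun c d ↦ (integrable_const _).add ((hsq.div_const 4).const_mul d)
  -- One-sided regularity: the first distribution function increases and the second is 1-Lipschitz,
  -- so Δ drops by at most 4ε over a window of length 4ε.
  have hincr : ∀ {y w : ℝ}, w ≤ y → y ≤ w + 4 * ε → Δ w - 4 * ε ≤ Δ y := fun {y w} h1 h2 ↦ by
    have h3 := monotone_cdf ν h1
    have h4 := (abs_le.1 (abs_stdCDF_sub_le w y)).2
    rw [abs_of_nonneg (by linarith)] at h4
    simp only [hΔ]
    linarith
  have hmain : ∀ w, |Δ w| ≤ 4 / 3 * (R + 5 * ε + D / 4) := fun w ↦ by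
    have hw := abs_le.1 (hΔD w)
    -- Centring the smoothing at w + 2ε keeps w + 2ε - εt in the window for |t| ≤ 2. For |t| > 2
    -- only Δ ≥ -D is available, and t² / 4 ≥ 1 absorbs the loss as in Chebyshev's inequality. The
    -- lower bound is reflected, centred at w - 2ε.
    have hup : Δ w - 4 * ε + -(D + Δ w) / 4 ≤ R + ε := by
      rw [← hquad]
      refine le_trans (integral_mono (hquadi _ _) (hint (w + 2 * ε)) fun t ↦ ?_)
        (abs_le.1 (hsm (w + 2 * ε))).2
      dsimp only
      have hb := abs_le.1 (hΔD (w + 2 * ε - ε * t))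
      rcases le_or_gt |t| 2 with ht | ht
      · have := abs_le.1 ht
        have h1 := hincr (w := w) (y := w + 2 * ε - ε * t) (by nlinarith) (by nlinarith)
        have : 0 ≤ (D + Δ w) * (t ^ 2 / 4) := mul_nonneg (by linarith) (by positivity)
        linarith
      · have h4 : 1 ≤ t ^ 2 / 4 := by nlinarith [sq_abs t]
        have : 0 ≤ (D + Δ w) * (t ^ 2 / 4 - 1) := mul_nonneg (by linarith) (by linarith)
        linarith
    have hlo : -(R + ε) ≤ Δ w + 4 * ε + (D - Δ w) / 4 := by
      rw [← hquad]
      refine le_trans (abs_le.1 (hsm (w - 2 * ε))).1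
        (integral_mono (hint (w - 2 * ε)) (hquadi _ _) fun t ↦ ?_)
      dsimp only
      have hb := abs_le.1 (hΔD (w - 2 * ε - ε * t))
      rcases le_or_gt |t| 2 with ht | ht
      · have := abs_le.1 ht
        have h1 := hincr (w := w - 2 * ε - ε * t) (y := w) (by nlinarith) (by nlinarith)
        have : 0 ≤ (D - Δ w) * (t ^ 2 / 4) := mul_nonneg (by linarith) (by positivity)
        linarith
      · have h4 : 1 ≤ t ^ 2 / 4 := by nlinarith [sq_abs t]
        have : 0 ≤ (D - Δ w) * (t ^ 2 / 4 - 1) := mul_nonneg (by linarith) (by linarith)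
        linarith
    rw [abs_le]
    constructor <;> linarith
  -- The term D / 3 on the right is absorbed into the left.
  have : D ≤ 4 / 3 * (R + 5 * ε + D / 4) := ciSup_le hmain
  linarith

/-! ### Lindeberg's method for martingales. -/

variable {Ω : Type u} {m : MeasurableSpace Ω}

lemma continuous_heat (s : ℝ) : Continuous (heat s) :=
  continuous_stdCDF.comp (continuous_id.div_const _)

lemma continuous_heat' (s : ℝ) : Continuous (heat' s) :=
  (continuous_stdPDF.comp (continuous_id.div_const _)).div_const _

lemma continuous_heat'' (s : ℝ) : Continuous (heat'' s) :=
  (continuous_stdPDF'.comp (continuous_id.div_const _)).div_const _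

lemma abs_heat_le (s x : ℝ) : |heat s x| ≤ 1 := by
  have := stdCDF_mem_Icc (x / Real.sqrt s)
  rw [heat, abs_of_nonneg this.1]; exact this.2

lemma abs_heat'_le (s x : ℝ) : |heat' s x| ≤ 1 / Real.sqrt s := by
  rw [heat', abs_div, abs_of_nonneg (Real.sqrt_nonneg s), abs_of_nonneg (stdPDF_nonneg _)]
  exact div_le_div_of_nonneg_right (stdPDF_le_one _) (Real.sqrt_nonneg s)

lemma integral_mul_condExp {m₀ m : MeasurableSpace Ω} {μ : Measure Ω} [IsProbabilityMeasure μ]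
    (hm : m₀ ≤ m) {Y f : Ω → ℝ} {C : ℝ} (hY : Measurable[m₀] Y) (hC : ∀ ω, |Y ω| ≤ C)
    (hf : Integrable f μ) :
    ∫ ω, Y ω * f ω ∂μ = ∫ ω, Y ω * (μ[f | m₀]) ω ∂μ := by
  have hYf : Integrable (Y * f) μ :=
    hf.bdd_mul (c := C) (hY.mono hm le_rfl).aestronglyMeasurable
      (Filter.Eventually.of_forall hC)
  have h := condExp_mul_of_stronglyMeasurable_left (m := m₀) hY.stronglyMeasurable hYf hf
  calc ∫ ω, Y ω * f ω ∂μ = ∫ ω, (μ[Y * f | m₀]) ω ∂μ := (integral_condExp hm).symm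
    _ = ∫ ω, Y ω * (μ[f | m₀]) ω ∂μ := integral_congr_ae h

lemma sigma_nonneg (ξ : ℕ → Ω → ℝ) (μ : Measure Ω) (k : ℕ) : 0 ≤ sigma ξ μ k :=
  Real.sqrt_nonneg _

lemma sigma_sq (ξ : ℕ → Ω → ℝ) (μ : Measure Ω) (k : ℕ) :
    sigma ξ μ k ^ 2 = ∫ ω, ξ k ω ^ 2 ∂μ :=
  Real.sq_sqrt (integral_nonneg fun _ ↦ sq_nonneg _)

lemma V_succ (ξ : ℕ → Ω → ℝ) (μ : Measure Ω) (n : ℕ) :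
    V ξ μ (n + 1) = V ξ μ n + sigma ξ μ (n + 1) ^ 2 := by
  rw [V, Finset.sum_Icc_succ_top (by omega), V]

lemma V_mono (ξ : ℕ → Ω → ℝ) (μ : Measure Ω) : Monotone (V ξ μ) :=
  monotone_nat_of_le_succ fun n ↦ by rw [V_succ]; nlinarith [sq_nonneg (sigma ξ μ (n + 1))]

lemma partialSum_succ (ξ : ℕ → Ω → ℝ) (n : ℕ) (ω : Ω) :
    partialSum ξ (n + 1) ω = partialSum ξ n ω + ξ (n + 1) ω := by
  rw [partialSum, Finset.sum_Icc_succ_top (by omega), partialSum]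

section Lindeberg

variable {μ : Measure Ω} {ℱ : Filtration ℕ m} {ξ : ℕ → Ω → ℝ} {p : ℝ}

lemma IsMartingaleDifference.measurable_partialSum (hξ : IsMartingaleDifference ξ ℱ μ) (n : ℕ) :
    Measurable[ℱ n] (partialSum ξ n) := by
  unfold partialSum
  refine Finset.measurable_fun_sum _ fun k hk ↦ ?_
  rw [Finset.mem_Icc] at hk
  exact (hξ.measurable k hk.1).mono (ℱ.mono hk.2) le_rfl

lemma integrable_sq_of_memLp [IsProbabilityMeasure μ] {f : Ω → ℝ} (hp : 2 ≤ p) (hf : MemLp f (ENNReal.ofReal p) μ) :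
    Integrable (fun ω ↦ f ω ^ 2) μ := by
  refine (hf.mono_exponent ?_).integrable_sq
  rw [← ENNReal.ofReal_ofNat]
  exact ENNReal.ofReal_le_ofReal hp

lemma integrable_rpow_of_memLp {f : Ω → ℝ} (hp : 2 ≤ p) (hf : MemLp f (ENNReal.ofReal p) μ) :
    Integrable (fun ω ↦ |f ω| ^ p) μ := by
  have h := hf.integrable_norm_rpow (by simp; linarith) (by simp)
  rw [ENNReal.toReal_ofReal (by linarith)] at h
  simpa using h

/-- Jensen's inequality between the second and the `p`-th moment. -/
lemma sigma_rpow_le [IsProbabilityMeasure μ] (hp : 2 ≤ p) {k : ℕ} (hk : MemLp (ξ k) (ENNReal.ofReal p) μ) :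
    sigma ξ μ k ^ p ≤ ∫ ω, |ξ k ω| ^ p ∂μ := by
  rcases (sigma_nonneg ξ μ k).eq_or_lt with h | h
  · rw [← h, Real.zero_rpow (by linarith)]
    exact integral_nonneg fun ω ↦ by positivity
  · set σ := sigma ξ μ k
    -- The tangent line of t^{p/2} at t = 1, with t = ξ_k² / σ_k²; its linear part has mean zero.
    have hpt : ∀ ω, σ ^ p * (1 + p / 2 * (ξ k ω ^ 2 / σ ^ 2 - 1)) ≤ |ξ k ω| ^ p := fun ω ↦ by
      have h1 := one_add_mul_self_le_rpow_one_add (s := ξ k ω ^ 2 / σ ^ 2 - 1) (p := p / 2)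
        (by linarith [show 0 ≤ ξ k ω ^ 2 / σ ^ 2 by positivity]) (by linarith)
      have h2 : (1 + (ξ k ω ^ 2 / σ ^ 2 - 1)) ^ (p / 2) = |ξ k ω| ^ p / σ ^ p := by
        rw [add_sub_cancel, ← sq_abs, ← div_pow, ← Real.rpow_natCast,
          ← Real.rpow_mul (by positivity), Real.div_rpow (abs_nonneg _) h.le]
        congr 2 <;> (push_cast; ring)
      rw [h2, le_div_iff₀ (by positivity), mul_comm] at h1
      exact h1
    have hi := integrable_sq_of_memLp hp hk
    have hi1 : Integrable (fun ω ↦ p / 2 * (ξ k ω ^ 2 / σ ^ 2 - 1)) μ :=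
      ((hi.div_const (σ ^ 2)).sub (integrable_const 1)).const_mul (p / 2)
    have := integral_mono (((integrable_const 1).add hi1).const_mul (σ ^ p))
      (integrable_rpow_of_memLp hp hk) hpt
    refine le_trans (le_of_eq ?_) this
    simp only [Pi.add_apply]
    rw [integral_const_mul, integral_add (integrable_const 1) hi1,
      integral_const_mul, integral_sub (hi.div_const (σ ^ 2)) (integrable_const 1), integral_div,
      ← sigma_sq]
    have : sigma ξ μ k ^ 2 / σ ^ 2 = 1 := div_self (by positivity)
    simp [this]

lemma IsMartingaleDifference.measurable_of_le (hξ : IsMartingaleDifference ξ ℱ μ) {k : ℕ}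
    (hk : 1 ≤ k) : Measurable (ξ k) :=
  (hξ.measurable k hk).mono (ℱ.le k) le_rfl

/-- Conditioning in front of the sums which enter `U`. -/
lemma integral_mul_sum_sq_sub [IsProbabilityMeasure μ] (hp : 2 ≤ p) (hL : ∀ k, 1 ≤ k → MemLp (ξ k) (ENNReal.ofReal p) μ)
    {Y : Ω → ℝ} {C : ℝ} {l n : ℕ} (hl : 1 ≤ l) (j : ℕ) (hY : Measurable[ℱ j] Y)
    (hC : ∀ ω, |Y ω| ≤ C) :
    ∫ ω, Y ω * ∑ k ∈ Finset.Icc l n, (ξ k ω ^ 2 - sigma ξ μ k ^ 2) ∂μ =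
      ∫ ω, Y ω * ∑ k ∈ Finset.Icc l n,
        ((μ[fun ω' ↦ ξ k ω' ^ 2 | ℱ j]) ω - sigma ξ μ k ^ 2) ∂μ := by
  have hYm : AEStronglyMeasurable Y μ := (hY.mono (ℱ.le j) le_rfl).aestronglyMeasurable
  have hb : ∀ f : Ω → ℝ, Integrable f μ → Integrable (fun ω ↦ Y ω * f ω) μ := fun f hf ↦
    hf.bdd_mul (c := C) hYm (Filter.Eventually.of_forall hC)
  have hsq : ∀ k ∈ Finset.Icc l n, Integrable (fun ω ↦ ξ k ω ^ 2) μ := fun k hk ↦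
    integrable_sq_of_memLp hp (hL k (hl.trans (Finset.mem_Icc.1 hk).1))
  have hc : ∀ k, Integrable (fun ω ↦ Y ω * sigma ξ μ k ^ 2) μ := fun k ↦
    hb (fun _ ↦ sigma ξ μ k ^ 2) (integrable_const _)
  simp only [Finset.mul_sum, mul_sub]
  rw [integral_finsetSum, integral_finsetSum]
  rotate_left
  · exact fun k hk ↦ (hb _ integrable_condExp).sub (hc k)
  · exact fun k hk ↦ (hb _ (hsq k hk)).sub (hc k)
  refine Finset.sum_congr rfl fun k hk ↦ ?_
  replace hc := hc k
  rw [integral_sub (hb _ (hsq k hk)) hc, integral_sub (hb _ integrable_condExp) hc,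
    integral_mul_condExp (ℱ.le j) hY hC (hsq k hk)]

/-- Needed because a nonintegrable integrand would make `U` equal to 0 by default, and `U` must
dominate other integrals. The weight is unbounded, but its product with ξ_k² is controlled by p-th
powers; pulling the weight into the conditional expectation then gives integrability. -/
lemma integrable_U [IsProbabilityMeasure μ] (hξ : IsMartingaleDifference ξ ℱ μ) (hp : 2 ≤ p)
    (hL : ∀ k, 1 ≤ k → MemLp (ξ k) (ENNReal.ofReal p) μ) {l n : ℕ} (hl : 2 ≤ l) :
    Integrable (fun ω ↦ max |ξ (l - 1) ω| (sigma ξ μ (l - 1)) ^ (p - 2) *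
      |∑ k ∈ Finset.Icc l n,
        ((μ[fun ω' ↦ ξ k ω' ^ 2 | ℱ (l - 1)]) ω - sigma ξ μ k ^ 2)|) μ := by
  set σ := sigma ξ μ (l - 1)
  set Z : Ω → ℝ := fun ω ↦ max |ξ (l - 1) ω| σ ^ (p - 2) with hZ
  have hσ : 0 ≤ σ := sigma_nonneg _ _ _
  have hZm : Measurable[ℱ (l - 1)] Z := by
    have h := hξ.measurable (l - 1) (by omega)
    have hc : Continuous fun y : ℝ ↦ max |y| σ ^ (p - 2) :=
      (continuous_abs.max continuous_const).rpow_const fun _ ↦ Or.inr (by linarith)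
    exact hc.measurable.comp h
  have hZm' : Measurable Z := hZm.mono (ℱ.le _) le_rfl
  have hZf : ∀ f : Ω → ℝ, Measurable f → MemLp f (ENNReal.ofReal p) μ →
      Integrable (fun ω ↦ Z ω * f ω ^ 2) μ := fun f hfm hf ↦ by
    refine Integrable.mono' (((integrable_rpow_of_memLp hp (hL (l - 1) (by omega))).add
      (integrable_const (σ ^ p))).add (integrable_rpow_of_memLp hp hf))
      (hZm'.mul (hfm.pow_const 2)).aestronglyMeasurable (Filter.Eventually.of_forall fun ω ↦ ?_)
    have h0 : 0 ≤ max |ξ (l - 1) ω| σ := le_max_of_le_right hσ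
    have h1 := rpow_mul_sq_le hp h0 (abs_nonneg (f ω))
    rw [sq_abs] at h1
    rw [Real.norm_eq_abs, abs_of_nonneg (by positivity)]
    refine h1.trans ?_
    simp only [Pi.add_apply]
    gcongr
    rcases max_cases |ξ (l - 1) ω| σ with h | h <;> rw [h.1]
    · exact le_add_of_nonneg_right (by positivity)
    · exact le_add_of_nonneg_left (by positivity)
  have hZi : Integrable Z μ := by
    have := hZf (fun _ ↦ 1) measurable_const (memLp_const 1)
    simpa using this
  have hmain : Integrable (fun ω ↦ ∑ k ∈ Finset.Icc l n,
      (Z ω * (μ[fun ω' ↦ ξ k ω' ^ 2 | ℱ (l - 1)]) ω - Z ω * sigma ξ μ k ^ 2)) μ := by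
    refine integrable_finsetSum _ fun k hk ↦ Integrable.sub ?_ (hZi.mul_const _)
    have hk1 : 1 ≤ k := by have := (Finset.mem_Icc.1 hk).1; omega
    have h := condExp_mul_of_stronglyMeasurable_left (m := ℱ (l - 1)) (μ := μ)
      hZm.stronglyMeasurable (hZf (ξ k) (hξ.measurable_of_le hk1) (hL k hk1))
      (integrable_sq_of_memLp hp (hL k hk1))
    exact integrable_condExp.congr h
  refine hmain.abs.congr (Filter.Eventually.of_forall fun ω ↦ ?_)
  have h0 : 0 ≤ Z ω := Real.rpow_nonneg (le_max_of_le_right hσ) _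
  simp only [← mul_sub, ← Finset.mul_sum]
  rw [abs_mul, abs_of_nonneg h0]

/-- The expected effect of one Lindeberg step. -/
lemma abs_integral_heat_exchange_le [IsProbabilityMeasure μ] (hξ : IsMartingaleDifference ξ ℱ μ) (hp2 : 2 ≤ p)
    (hp3 : p ≤ 3) (hL : ∀ k, 1 ≤ k → MemLp (ξ k) (ENNReal.ofReal p) μ) {s : ℝ} (hs : 0 < s)
    (x : ℝ) (k : ℕ) :
    |∫ ω, heat s (x - partialSum ξ (k + 1) ω) ∂μ
        - ∫ ω, heat (s + sigma ξ μ (k + 1) ^ 2) (x - partialSum ξ k ω) ∂μ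
        - (∫ ω, heat'' (s + sigma ξ μ (k + 1) ^ 2) (x - partialSum ξ k ω) *
            (ξ (k + 1) ω ^ 2 - sigma ξ μ (k + 1) ^ 2) ∂μ) / 2|
      ≤ 18 * ((∫ ω, |ξ (k + 1) ω| ^ p ∂μ) / s ^ (p / 2)) := by
  set σ := sigma ξ μ (k + 1)
  have hσ : 0 ≤ σ := sigma_nonneg _ _ _
  have hσs : 0 < s + σ ^ 2 := by positivity
  have hS : ∀ j, Measurable[ℱ j] fun ω ↦ x - partialSum ξ j ω := fun j ↦
    measurable_const.sub (hξ.measurable_partialSum j)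
  have hS' : ∀ j, Measurable fun ω ↦ x - partialSum ξ j ω := fun j ↦ (hS j).mono (ℱ.le j) le_rfl
  have hLk := hL (k + 1) (by omega)
  have hi0 : ∀ t j, Integrable (fun ω ↦ heat t (x - partialSum ξ j ω)) μ := fun t j ↦
    Integrable.of_bound ((continuous_heat t).measurable.comp (hS' j)).aestronglyMeasurable 1
      (Filter.Eventually.of_forall fun ω ↦ abs_heat_le _ _)
  have hi1 : Integrable (fun ω ↦ heat' s (x - partialSum ξ k ω) * ξ (k + 1) ω) μ :=
    (hξ.integrable (k + 1) (by omega)).bdd_mul (c := 1 / Real.sqrt s)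
      ((continuous_heat' s).measurable.comp (hS' k)).aestronglyMeasurable
      (Filter.Eventually.of_forall fun ω ↦ abs_heat'_le _ _)
  have hi2 : Integrable (fun ω ↦ heat'' (s + σ ^ 2) (x - partialSum ξ k ω) *
      (ξ (k + 1) ω ^ 2 - σ ^ 2)) μ :=
    ((integrable_sq_of_memLp hp2 hLk).sub (integrable_const _)).bdd_mul (c := 1 / (s + σ ^ 2))
      ((continuous_heat'' _).measurable.comp (hS' k)).aestronglyMeasurable
      (Filter.Eventually.of_forall fun ω ↦ abs_heat''_le hσs _)
  have hip := integrable_rpow_of_memLp hp2 hLk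
  -- The only use of the martingale property in a step: the first order term vanishes.
  have hz : ∫ ω, heat' s (x - partialSum ξ k ω) * ξ (k + 1) ω ∂μ = 0 := by
    rw [integral_mul_condExp (Y := fun ω ↦ heat' s (x - partialSum ξ k ω)) (ℱ.le k)
      ((continuous_heat' s).measurable.comp (hS k))
      (fun ω ↦ abs_heat'_le s _) (hξ.integrable (k + 1) (by omega))]
    have h0 := hξ.condExp_eq_zero (k + 1) (by omega)
    rw [Nat.add_sub_cancel] at h0
    rw [integral_congr_ae (g := 0)]
    · simp
    · filter_upwards [h0] with ω hω
      simp [hω]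
  have heq : ∫ ω, heat s (x - partialSum ξ (k + 1) ω) ∂μ
        - ∫ ω, heat (s + σ ^ 2) (x - partialSum ξ k ω) ∂μ
        - (∫ ω, heat'' (s + σ ^ 2) (x - partialSum ξ k ω) * (ξ (k + 1) ω ^ 2 - σ ^ 2) ∂μ) / 2
      = ∫ ω, (heat s (x - partialSum ξ k ω - ξ (k + 1) ω)
        - heat (s + σ ^ 2) (x - partialSum ξ k ω) + heat' s (x - partialSum ξ k ω) * ξ (k + 1) ω
        - heat'' (s + σ ^ 2) (x - partialSum ξ k ω) * (ξ (k + 1) ω ^ 2 - σ ^ 2) / 2) ∂μ := by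
    have hrw : ∀ ω, x - partialSum ξ k ω - ξ (k + 1) ω = x - partialSum ξ (k + 1) ω := fun ω ↦ by
      rw [partialSum_succ]; ring
    simp only [hrw]
    have hi3 : Integrable (fun ω ↦ heat s (x - partialSum ξ (k + 1) ω)
        - heat (s + σ ^ 2) (x - partialSum ξ k ω)) μ := (hi0 _ _).sub (hi0 _ _)
    have hi4 : Integrable (fun ω ↦ heat s (x - partialSum ξ (k + 1) ω)
        - heat (s + σ ^ 2) (x - partialSum ξ k ω)
        + heat' s (x - partialSum ξ k ω) * ξ (k + 1) ω) μ := hi3.add hi1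
    rw [integral_sub hi4 (hi2.div_const 2), integral_add hi3 hi1, integral_sub (hi0 _ _) (hi0 _ _), hz,
      integral_div, add_zero]
  rw [heq]
  have hbound : ∫ ω, 9 * ((|ξ (k + 1) ω| ^ p + σ ^ p) / s ^ (p / 2)) ∂μ
      ≤ 18 * ((∫ ω, |ξ (k + 1) ω| ^ p ∂μ) / s ^ (p / 2)) := by
    rw [integral_const_mul, integral_div, integral_add hip (integrable_const _)]
    have h1 := sigma_rpow_le hp2 hLk
    simp only [integral_const, probReal_univ, one_smul]
    calc _ ≤ 9 * ((∫ ω, |ξ (k + 1) ω| ^ p ∂μ + ∫ ω, |ξ (k + 1) ω| ^ p ∂μ) / s ^ (p / 2)) := by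
          gcongr
      _ = _ := by ring
  refine le_trans ?_ hbound
  rw [← Real.norm_eq_abs]
  refine norm_integral_le_of_norm_le (((hip.add (integrable_const _)).div_const _).const_mul 9)
    (Filter.Eventually.of_forall fun ω ↦ ?_)
  exact abs_heat_exchange_le hp2 hp3 hs hσ _ _

/-- Abel summation. -/
lemma sum_mul_sub_eq (Y T : ℕ → ℝ) (j : ℕ) :
    ∑ i ∈ Finset.range (j + 1), Y i * (T i - T (i + 1)) =
      Y 0 * T 0 - Y j * T (j + 1) + ∑ i ∈ Finset.range j, (Y (i + 1) - Y i) * T (i + 1) := by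
  induction j with
  | zero => simp; ring
  | succ j ih => rw [Finset.sum_range_succ, ih, Finset.sum_range_succ _ j]; ring

lemma integral_sum_sq_sub [IsProbabilityMeasure μ] (hp : 2 ≤ p)
    (hL : ∀ k, 1 ≤ k → MemLp (ξ k) (ENNReal.ofReal p) μ) (n : ℕ) :
    ∫ ω, ∑ k ∈ Finset.Icc 1 n, (ξ k ω ^ 2 - sigma ξ μ k ^ 2) ∂μ = 0 := by
  have hi : ∀ k ∈ Finset.Icc 1 n, Integrable (fun ω ↦ ξ k ω ^ 2) μ := fun k hk ↦
    integrable_sq_of_memLp hp (hL k (Finset.mem_Icc.1 hk).1)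
  rw [integral_finsetSum]
  · refine Finset.sum_eq_zero fun k hk ↦ ?_
    rw [integral_sub (hi k hk) (integrable_const _), sigma_sq]
    simp
  · exact fun k hk ↦ (hi k hk).sub (integrable_const _)

/-- Lindeberg's method: the law of the martingale, smoothed by a centred normal law of variance
`ε ^ 2`, is compared with the centred normal law of variance `V + ε ^ 2`. The second error term
comes from a summation by parts in the conditional variances. -/
theorem abs_integral_heat_sub_le [IsProbabilityMeasure μ] (hξ : IsMartingaleDifference ξ ℱ μ)
    (hp2 : 2 ≤ p) (hp3 : p ≤ 3) (hL : ∀ k, 1 ≤ k → MemLp (ξ k) (ENNReal.ofReal p) μ) {ε : ℝ}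
    (hε : 0 < ε) (x : ℝ) (j : ℕ) :
    |∫ ω, heat (ε ^ 2) (x - partialSum ξ (j + 1) ω) ∂μ - heat (V ξ μ (j + 1) + ε ^ 2) x| ≤
      18 * ∑ i ∈ Finset.range (j + 1), (∫ ω, |ξ (i + 1) ω| ^ p ∂μ) /
          (V ξ μ (j + 1) - V ξ μ (i + 1) + ε ^ 2) ^ (p / 2) +
      9 / 2 * ∑ i ∈ Finset.range j, U ξ ℱ μ (j + 1) p (i + 2) /
          (V ξ μ (j + 1) - V ξ μ (i + 1) + ε ^ 2) ^ (p / 2) := by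
  set n := j + 1 with hn
  set s : ℕ → ℝ := fun k ↦ V ξ μ n - V ξ μ k + ε ^ 2 with hs
  have hs_succ : ∀ k, s (k + 1) + sigma ξ μ (k + 1) ^ 2 = s k := fun k ↦ by
    simp only [hs, V_succ]; ring
  have hs_pos : ∀ k, k ≤ n → 0 < s k := fun k hk ↦ by
    have := V_mono ξ μ hk
    have : 0 < ε ^ 2 := by positivity
    simp only [hs]; linarith
  set Y : ℕ → Ω → ℝ := fun k ω ↦ heat'' (s k) (x - partialSum ξ k ω) with hY
  set T : ℕ → Ω → ℝ := fun k ω ↦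
    ∑ i ∈ Finset.Icc (k + 1) n, (ξ i ω ^ 2 - sigma ξ μ i ^ 2) with hT
  have hS : ∀ k, Measurable[ℱ k] fun ω ↦ x - partialSum ξ k ω := fun k ↦
    measurable_const.sub (hξ.measurable_partialSum k)
  have hYm : ∀ k, Measurable[ℱ k] (Y k) := fun k ↦ (continuous_heat'' _).measurable.comp (hS k)
  have hYb : ∀ k, k ≤ n → ∀ ω, |Y k ω| ≤ 1 / s k := fun k hk ω ↦ abs_heat''_le (hs_pos k hk) _
  have hTi : ∀ k, Integrable (T k) μ := fun k ↦ integrable_finsetSum _ fun i hi ↦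
    (integrable_sq_of_memLp hp2 (hL i (by have := (Finset.mem_Icc.1 hi).1; omega))).sub
      (integrable_const _)
  have hYT : ∀ k l, k ≤ n → Integrable (fun ω ↦ Y k ω * T l ω) μ := fun k l hk ↦
    (hTi l).bdd_mul (c := 1 / s k) ((hYm k).mono (ℱ.le k) le_rfl).aestronglyMeasurable
      (Filter.Eventually.of_forall (hYb k hk))
  have hT_succ : ∀ k, k < n → ∀ ω, ξ (k + 1) ω ^ 2 - sigma ξ μ (k + 1) ^ 2 = T k ω - T (k + 1) ω :=
    fun k hk ω ↦ by
      simp only [hT]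
      rw [← Finset.add_sum_Ioc_eq_sum_Icc (a := k + 1) (by omega)]
      have : Finset.Icc (k + 1 + 1) n = Finset.Ioc (k + 1) n := by ext; simp
      rw [this]; ring
  -- the telescoping sum
  set E : ℕ → ℝ := fun k ↦ ∫ ω, heat (s k) (x - partialSum ξ k ω) ∂μ with hE
  set Q : ℕ → ℝ := fun k ↦ ∫ ω, Y k ω * (ξ (k + 1) ω ^ 2 - sigma ξ μ (k + 1) ^ 2) ∂μ with hQ
  have hstep : ∀ k, k < n → |E (k + 1) - E k - Q k / 2| ≤
      18 * ((∫ ω, |ξ (k + 1) ω| ^ p ∂μ) / s (k + 1) ^ (p / 2)) := fun k hk ↦ by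
    have h := abs_integral_heat_exchange_le hξ hp2 hp3 hL (hs_pos (k + 1) (by omega)) x k
    rw [hs_succ] at h
    exact h
  have hEn : E n = ∫ ω, heat (ε ^ 2) (x - partialSum ξ n ω) ∂μ := by simp [hE, hs]
  have hE0 : E 0 = heat (V ξ μ n + ε ^ 2) x := by simp [hE, hs, partialSum, V]
  have hsum : |E n - E 0 - (∑ k ∈ Finset.range n, Q k) / 2| ≤
      18 * ∑ k ∈ Finset.range n, (∫ ω, |ξ (k + 1) ω| ^ p ∂μ) / s (k + 1) ^ (p / 2) := by
    rw [← Finset.sum_range_sub E n, Finset.sum_div, ← Finset.sum_sub_distrib, Finset.mul_sum]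
    exact (Finset.abs_sum_le_sum_abs _ _).trans
      (Finset.sum_le_sum fun k hk ↦ hstep k (Finset.mem_range.1 hk))
  -- summation by parts
  have hQsum : ∑ k ∈ Finset.range n, Q k =
      ∑ i ∈ Finset.range j, ∫ ω, (Y (i + 1) ω - Y i ω) * T (i + 1) ω ∂μ := by
    have h1 : ∑ k ∈ Finset.range n, Q k =
        ∫ ω, ∑ k ∈ Finset.range n, Y k ω * (T k ω - T (k + 1) ω) ∂μ := by
      rw [integral_finsetSum]
      · refine Finset.sum_congr rfl fun k hk ↦ ?_
        simp only [hQ]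
        congr 1
        ext ω
        rw [hT_succ k (Finset.mem_range.1 hk)]
      · intro k hk
        have hk' := (Finset.mem_range.1 hk).le
        simp only [mul_sub]
        exact (hYT k k hk').sub (hYT k (k + 1) hk')
    -- Both boundary terms drop out: T_n is an empty sum, and Y_0 is deterministic while T_0 has
    -- mean zero.
    have h2 : ∀ ω, ∑ k ∈ Finset.range n, Y k ω * (T k ω - T (k + 1) ω) =
        heat'' (s 0) x * T 0 ω + ∑ i ∈ Finset.range j, (Y (i + 1) ω - Y i ω) * T (i + 1) ω :=
      fun ω ↦ by
        have h3 := sum_mul_sub_eq (fun k ↦ Y k ω) (fun k ↦ T k ω) j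
        have h4 : T (j + 1) ω = 0 := by simp [hT, hn]
        have h5 : Y 0 ω = heat'' (s 0) x := by simp [hY, partialSum]
        rw [h4, h5] at h3
        rw [hn, h3]; ring
    have hd : ∀ i ∈ Finset.range j,
        Integrable (fun ω ↦ (Y (i + 1) ω - Y i ω) * T (i + 1) ω) μ := fun i hi ↦ by
      have := Finset.mem_range.1 hi
      simp only [sub_mul]
      exact (hYT _ _ (by omega)).sub (hYT _ _ (by omega))
    rw [h1]
    simp only [h2]
    rw [integral_add ((hTi 0).const_mul _) (integrable_finsetSum _ hd), integral_const_mul,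
      integral_finsetSum _ hd]
    have h6 : ∫ ω, T 0 ω ∂μ = 0 := integral_sum_sq_sub hp2 hL n
    rw [h6]; simp
  -- Y_{i+1} - Y_i is ℱ_{i+1}-measurable, so T_{i+1} may be conditioned on ℱ_{i+1}, which gives the
  -- sum in U_{i+2}. Changing the position by ξ_{i+1} costs 3 and the variance by σ_{i+1}² costs 6,
  -- each times the weight over s_{i+1}^{p/2}.
  have hQU : ∀ i ∈ Finset.range j, |∫ ω, (Y (i + 1) ω - Y i ω) * T (i + 1) ω ∂μ| ≤
      9 * (U ξ ℱ μ n p (i + 2) / s (i + 1) ^ (p / 2)) := fun i hi ↦ by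
    have hij := Finset.mem_range.1 hi
    have hpos := hs_pos (i + 1) (by omega)
    have hint := integrable_U (n := n) hξ hp2 hL (l := i + 2) (by omega)
    have h1 := integral_mul_sum_sq_sub hp2 hL (Y := fun ω ↦ Y (i + 1) ω - Y i ω) (n := n)
      (C := 1 / s (i + 1) + 1 / s i) (l := i + 1 + 1) (by omega) (i + 1)
      ((hYm (i + 1)).sub ((hYm i).mono (ℱ.mono (by omega)) le_rfl))
      (fun ω ↦ (abs_sub _ _).trans (add_le_add (hYb _ (by omega) ω) (hYb _ (by omega) ω)))
    have h2 : 9 * (U ξ ℱ μ n p (i + 2) / s (i + 1) ^ (p / 2)) =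
        ∫ ω, 9 / s (i + 1) ^ (p / 2) * (max |ξ (i + 2 - 1) ω| (sigma ξ μ (i + 2 - 1)) ^ (p - 2) *
          |∑ k ∈ Finset.Icc (i + 2) n,
            ((μ[fun ω' ↦ ξ k ω' ^ 2 | ℱ (i + 2 - 1)]) ω - sigma ξ μ k ^ 2)|) ∂μ := by
      rw [integral_const_mul, U]; ring
    simp only [hT]
    rw [h1, h2, ← Real.norm_eq_abs]
    refine norm_integral_le_of_norm_le (hint.const_mul _) (Filter.Eventually.of_forall fun ω ↦ ?_)
    rw [Real.norm_eq_abs, abs_mul, ← mul_assoc]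
    refine mul_le_mul_of_nonneg_right ?_ (abs_nonneg _)
    have hσ : 0 ≤ sigma ξ μ (i + 1) := sigma_nonneg _ _ _
    have h3 := abs_heat''_sub_le hp2 hp3 hpos (x - partialSum ξ i ω) (x - partialSum ξ (i + 1) ω)
    have h4 := abs_heat''_variance_sub_le hp2 hp3 hpos hσ (x - partialSum ξ i ω)
    rw [hs_succ, abs_sub_comm] at h4
    have h5 : |x - partialSum ξ (i + 1) ω - (x - partialSum ξ i ω)| = |ξ (i + 1) ω| := by
      rw [partialSum_succ, ← abs_neg]; congr 1; ring
    rw [h5] at h3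
    have h6 : |Y (i + 1) ω - Y i ω| ≤ 3 * (|ξ (i + 1) ω| ^ (p - 2) / s (i + 1) ^ (p / 2)) +
        6 * (sigma ξ μ (i + 1) ^ (p - 2) / s (i + 1) ^ (p / 2)) :=
      (abs_sub_le _ (heat'' (s (i + 1)) (x - partialSum ξ i ω)) _).trans (add_le_add h3 h4)
    refine h6.trans ?_
    rw [show i + 2 - 1 = i + 1 by omega]
    have h7 : |ξ (i + 1) ω| ^ (p - 2) ≤ max |ξ (i + 1) ω| (sigma ξ μ (i + 1)) ^ (p - 2) :=
      Real.rpow_le_rpow (abs_nonneg _) (le_max_left _ _) (by linarith)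
    have h8 : sigma ξ μ (i + 1) ^ (p - 2) ≤ max |ξ (i + 1) ω| (sigma ξ μ (i + 1)) ^ (p - 2) :=
      Real.rpow_le_rpow hσ (le_max_right _ _) (by linarith)
    calc _ ≤ 3 * (max |ξ (i + 1) ω| (sigma ξ μ (i + 1)) ^ (p - 2) / s (i + 1) ^ (p / 2)) +
        6 * (max |ξ (i + 1) ω| (sigma ξ μ (i + 1)) ^ (p - 2) / s (i + 1) ^ (p / 2)) := by gcongr
      _ = _ := by ring
  have hQ' : |∑ k ∈ Finset.range n, Q k| ≤
      9 * ∑ i ∈ Finset.range j, U ξ ℱ μ n p (i + 2) / s (i + 1) ^ (p / 2) := by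
    rw [hQsum, Finset.mul_sum]
    exact (Finset.abs_sum_le_sum_abs _ _).trans (Finset.sum_le_sum hQU)
  rw [← hEn, ← hE0]
  rw [abs_le] at hsum hQ' ⊢
  constructor <;> linarith

end Lindeberg

/-! ### Summing the errors and removing the added variance. -/

/-- A discrete form of `∫ u in Set.Ioi (ε ^ 2), u ^ (-p / 2) ≤ C * ε ^ (2 - p)`. -/
lemma sum_div_rpow_le {p ε : ℝ} (hp : 2 < p) (hε : 0 < ε) {n : ℕ} {s v : ℕ → ℝ}
    (hv : ∀ i, 0 ≤ v i) (hvε : ∀ i < n, v i ≤ ε ^ 2) (hs : ∀ i, s i = s (i + 1) + v i)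
    (hsn : s n = ε ^ 2) :
    ∑ i ∈ Finset.range n, v i / s (i + 1) ^ (p / 2) ≤ 2 ^ (p / 2) / (p / 2 - 1) * ε ^ (2 - p) := by
  have hanti : Antitone s := antitone_nat_of_succ_le fun i ↦ by linarith [hs i, hv i]
  have hsε : ∀ i, i ≤ n → ε ^ 2 ≤ s i := fun i hi ↦ hsn ▸ hanti hi
  have hspos : ∀ i, i ≤ n → 0 < s i := fun i hi ↦ (by positivity : 0 < ε ^ 2).trans_le (hsε i hi)
  set α := p / 2 - 1 with hα
  have hα0 : 0 < α := by linarith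
  have hstep : ∀ i ∈ Finset.range n, v i / s (i + 1) ^ (p / 2) ≤
      2 ^ (p / 2) / α * (s (i + 1) ^ (-α) - s i ^ (-α)) := fun i hi ↦ by
    have hin := Finset.mem_range.1 hi
    have ha := hspos (i + 1) hin
    have hb := hspos i hin.le
    -- No increment exceeds ε² ≤ s_{i+1}, so replacing s_{i+1} by s_i in the denominator costs only
    -- 2^{p/2}.
    have hab : s i ≤ 2 * s (i + 1) := by linarith [hs i, hvε i hin, hsε (i + 1) hin]
    -- Convexity, (1 - u)^{-α} ≥ 1 + αu, which bounds each summand by a telescoping difference of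
    -- s^{-α}.
    have h1 : 1 + α * (v i / s i) ≤ (s (i + 1) / s i) ^ (-α) := by
      have hx : 0 < s (i + 1) / s i := by positivity
      have hx1 : s (i + 1) / s i - 1 = -(v i / s i) := by
        rw [hs i]; have := hs i ▸ hb; field_simp; ring
      rw [Real.rpow_def_of_pos hx]
      have h2 := Real.add_one_le_exp (Real.log (s (i + 1) / s i) * -α)
      have h3 := Real.log_le_sub_one_of_pos hx
      rw [hx1] at h3
      nlinarith
    rw [Real.div_rpow ha.le hb.le, le_div_iff₀ (by positivity)] at h1
    have h2 : s i ^ (-α) * (v i / s i) = v i / s i ^ (p / 2) := by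
      rw [show p / 2 = α + 1 by ring, Real.rpow_add hb, Real.rpow_one, Real.rpow_neg hb.le]
      field_simp
    have h3 : v i / s (i + 1) ^ (p / 2) ≤ 2 ^ (p / 2) * (v i / s i ^ (p / 2)) := by
      have h4 : s i ^ (p / 2) ≤ 2 ^ (p / 2) * s (i + 1) ^ (p / 2) := by
        rw [← Real.mul_rpow (by norm_num) ha.le]
        exact Real.rpow_le_rpow hb.le hab (by linarith)
      rw [← mul_div_assoc, div_le_div_iff₀ (by positivity) (by positivity)]
      calc v i * s i ^ (p / 2) ≤ v i * (2 ^ (p / 2) * s (i + 1) ^ (p / 2)) := by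
            have := hv i; gcongr
        _ = _ := by ring
    have h4 : v i / s i ^ (p / 2) ≤ (s (i + 1) ^ (-α) - s i ^ (-α)) / α := by
      rw [le_div_iff₀ hα0, ← h2]; linarith
    calc _ ≤ 2 ^ (p / 2) * (v i / s i ^ (p / 2)) := h3
      _ ≤ 2 ^ (p / 2) * ((s (i + 1) ^ (-α) - s i ^ (-α)) / α) := by gcongr
      _ = _ := by ring
  refine (Finset.sum_le_sum hstep).trans ?_
  rw [← Finset.mul_sum, Finset.sum_range_sub (fun i ↦ s i ^ (-α)), hsn]
  have h1 : (ε ^ 2) ^ (-α) = ε ^ (2 - p) := by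
    rw [← Real.rpow_natCast, ← Real.rpow_mul hε.le]
    congr 1; push_cast; rw [hα]; ring
  have h2 : 0 ≤ s 0 ^ (-α) := Real.rpow_nonneg (hspos 0 (by omega)).le _
  rw [h1]
  gcongr
  linarith

/-- With r = ε / √V, the heat equation gives r² / 2, which is at most r when r ≤ 1; otherwise the
bound is trivial. -/
lemma abs_heat_add_sub_le {V ε : ℝ} (hV : 0 < V) (hε : 0 < ε) (x : ℝ) :
    |heat (V + ε ^ 2) x - heat V x| ≤ ε / Real.sqrt V := by
  rcases le_total 1 (ε / Real.sqrt V) with h | h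
  · refine le_trans ?_ h
    have h1 := stdCDF_mem_Icc (x / Real.sqrt (V + ε ^ 2))
    have h2 := stdCDF_mem_Icc (x / Real.sqrt V)
    simp only [heat]
    rw [abs_le]
    constructor <;> linarith [h1.1, h1.2, h2.1, h2.2]
  · have h1 : |heat (V + ε ^ 2) x - heat V x| ≤ 1 / (2 * V) * |V + ε ^ 2 - V| := by
      have hle : ∀ t ∈ Set.uIcc V (V + ε ^ 2), V ≤ t := fun t ht ↦ by
        rw [Set.uIcc_of_le (by nlinarith)] at ht
        exact ht.1
      refine abs_sub_le_of_hasDerivAt (f := fun s ↦ heat s x)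
        (fun t ht ↦ hasDerivAt_heat_variance (hV.trans_le (hle t ht)) x) fun t ht ↦ ?_
      have ht := hle t ht
      have h2 := abs_heat''_le (hV.trans_le ht) x
      rw [abs_div, abs_two]
      calc |heat'' t x| / 2 ≤ 1 / t / 2 := by gcongr
        _ ≤ 1 / V / 2 := by gcongr
        _ = 1 / (2 * V) := by field_simp
    rw [add_sub_cancel_left, abs_of_nonneg (sq_nonneg ε)] at h1
    have h2 : 1 / (2 * V) * ε ^ 2 = (ε / Real.sqrt V) ^ 2 / 2 := by
      rw [div_pow, Real.sq_sqrt hV.le]; field_simp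
    have h3 : 0 ≤ ε / Real.sqrt V := by positivity
    rw [h2] at h1
    nlinarith

/-! ### Relations between δ_n, V_n, the moment ratio and L. -/

section Norms

variable {μ : Measure Ω} {ξ : ℕ → Ω → ℝ} {p : ℝ} {n : ℕ}

lemma sigma_le_delta {k : ℕ} (hk : k ∈ Finset.Icc 1 n) : sigma ξ μ k ≤ delta ξ μ n :=
  le_ciSup (f := fun k : Finset.Icc 1 n ↦ sigma ξ μ k) (Set.finite_range _).bddAbove ⟨k, hk⟩

lemma exists_sigma_eq_delta (hn : 1 ≤ n) : ∃ k ∈ Finset.Icc 1 n, sigma ξ μ k = delta ξ μ n := by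
  have : Nonempty (Finset.Icc 1 n) := ⟨⟨1, by simp [hn]⟩⟩
  obtain ⟨⟨k, hk⟩, h⟩ := exists_eq_ciSup_of_finite (f := fun k : Finset.Icc 1 n ↦ sigma ξ μ k)
  exact ⟨k, hk, h⟩

lemma sigma_sq_le_V {k : ℕ} (hk : k ∈ Finset.Icc 1 n) : sigma ξ μ k ^ 2 ≤ V ξ μ n :=
  Finset.single_le_sum (f := fun k ↦ sigma ξ μ k ^ 2) (fun _ _ ↦ sq_nonneg _) hk

lemma delta_pos (hV : 0 < V ξ μ n) : 0 < delta ξ μ n := by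
  by_contra! h
  refine hV.ne' (Finset.sum_eq_zero fun k hk ↦ ?_)
  have h1 := (sigma_le_delta (ξ := ξ) (μ := μ) hk).trans h
  rw [le_antisymm h1 (sigma_nonneg ξ μ k)]
  simp

lemma momentRatio_nonneg : 0 ≤ momentRatio ξ μ n p :=
  Real.iSup_nonneg fun k ↦ div_nonneg (integral_nonneg fun ω ↦ by positivity) (sq_nonneg _)

lemma integral_rpow_le_momentRatio_mul [IsProbabilityMeasure μ] (hp : 2 ≤ p) {k : ℕ}
    (hk : k ∈ Finset.Icc 1 n) (hL : MemLp (ξ k) (ENNReal.ofReal p) μ) :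
    ∫ ω, |ξ k ω| ^ p ∂μ ≤ momentRatio ξ μ n p * sigma ξ μ k ^ 2 := by
  rcases (sigma_nonneg ξ μ k).eq_or_lt with h | h
  · have h1 := sigma_sq ξ μ k
    rw [← h, zero_pow two_ne_zero, eq_comm, integral_eq_zero_iff_of_nonneg
      (fun _ ↦ sq_nonneg _) (integrable_sq_of_memLp hp hL)] at h1
    rw [← h, integral_congr_ae (g := 0)]
    · simp
    · filter_upwards [h1] with ω hω
      have : ξ k ω = 0 := by simpa using hω
      simp [this, Real.zero_rpow (by linarith : p ≠ 0)]
  · rw [← div_le_iff₀ (by positivity)]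
    exact le_ciSup (f := fun k : Finset.Icc 1 n ↦ (∫ ω, |ξ k ω| ^ p ∂μ) / sigma ξ μ k ^ 2)
      (Set.finite_range _).bddAbove ⟨k, hk⟩

/-- Jensen's inequality at an index where σ_k is maximal. It ensures that the smoothing scale chosen
later is at least δ_n. -/
lemma delta_rpow_le_momentRatio [IsProbabilityMeasure μ] (hp : 2 ≤ p) (hV : 0 < V ξ μ n)
    (hn : 1 ≤ n) (hL : ∀ k, 1 ≤ k → MemLp (ξ k) (ENNReal.ofReal p) μ) :
    delta ξ μ n ^ (p - 2) ≤ momentRatio ξ μ n p := by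
  have hδ := delta_pos hV
  obtain ⟨k, hk, hkδ⟩ := exists_sigma_eq_delta (ξ := ξ) (μ := μ) hn
  have hLk := hL k (Finset.mem_Icc.1 hk).1
  have h1 := (sigma_rpow_le hp hLk).trans (integral_rpow_le_momentRatio_mul hp hk hLk)
  rw [hkδ] at h1
  have h2 : delta ξ μ n ^ p = delta ξ μ n ^ (p - 2) * delta ξ μ n ^ 2 := by
    rw [← Real.rpow_natCast, ← Real.rpow_add hδ]; congr 1; push_cast; ring
  rw [h2] at h1
  exact le_of_mul_le_mul_right h1 (by positivity)

lemma U_nonneg (ℱ : Filtration ℕ m) (l : ℕ) : 0 ≤ U ξ ℱ μ n p l :=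
  integral_nonneg fun _ ↦ mul_nonneg
    (Real.rpow_nonneg ((abs_nonneg _).trans (le_max_left _ _)) _) (abs_nonneg _)

lemma L_nonneg (ℱ : Filtration ℕ m) (r d : ℝ) : 0 ≤ L ξ ℱ μ n p r d :=
  Finset.sum_nonneg fun l hl ↦ div_nonneg (U_nonneg ℱ l) <| Real.rpow_nonneg
    (add_nonneg (sub_nonneg.2 (V_mono ξ μ (by have := Finset.mem_Icc.1 hl; omega)))
      (sq_nonneg d)) _

lemma L_succ_eq (ℱ : Filtration ℕ m) (r d : ℝ) (j : ℕ) :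
    L ξ ℱ μ (j + 1) p r d = ∑ i ∈ Finset.range j, U ξ ℱ μ (j + 1) p (i + 2) /
      (V ξ μ (j + 1) - V ξ μ (i + 1) + d ^ 2) ^ ((p - r) / 2) := by
  have : Finset.Icc 2 (j + 1) = Finset.Ico 2 (j + 2) := by ext; simp; omega
  rw [L, this, Finset.sum_Ico_eq_sum_range]
  refine Finset.sum_congr (by simp) fun i _ ↦ ?_
  rw [show 2 + i = i + 2 by omega, show i + 2 - 1 = i + 1 by omega]

end Norms

/-! ### The Kolmogorov bound with the optimal smoothing scale. -/

/-- The constant in the Kolmogorov bound. -/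
def kolmogorovConst (p : ℝ) : ℝ := 36 * (2 ^ (p / 2) / (p / 2 - 1)) + 22

lemma kolmogorovConst_pos {p : ℝ} (hp : 2 < p) : 0 < kolmogorovConst p := by
  have : 0 < p / 2 - 1 := by linarith
  unfold kolmogorovConst; positivity

/-- The Kolmogorov bound for `p ∈ (2, 3]`. -/
theorem kolmogorovDist_le {μ : Measure Ω} [IsProbabilityMeasure μ] {ℱ : Filtration ℕ m}
    {ξ : ℕ → Ω → ℝ} {p : ℝ} (hξ : IsMartingaleDifference ξ ℱ μ) (hp2 : 2 < p) (hp3 : p ≤ 3)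
    (hL : ∀ k, 1 ≤ k → MemLp (ξ k) (ENNReal.ofReal p) μ) {n : ℕ} (hn : 1 ≤ n)
    (hV : 0 < V ξ μ n) :
    kolmogorovDist ξ μ n ≤ kolmogorovConst p * (V ξ μ n ^ (-((p - 2) / (2 * (p - 1)))) *
      (momentRatio ξ μ n p + L ξ ℱ μ n p (p - 2) (delta ξ μ n)) ^ (1 / (p - 1))) := by
  obtain ⟨j, rfl⟩ : ∃ j, n = j + 1 := ⟨n - 1, by omega⟩
  set n := j + 1 with hnj
  set W := V ξ μ n with hW
  set δ := delta ξ μ n with hδdef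
  set S := momentRatio ξ μ n p with hS
  set Λ := L ξ ℱ μ n p (p - 2) δ with hΛ
  set A := 2 ^ (p / 2) / (p / 2 - 1) with hA
  have hA0 : 0 ≤ A := by
    have : 0 < p / 2 - 1 := by linarith
    positivity
  have hδ : 0 < δ := delta_pos hV
  have hδS : δ ^ (p - 2) ≤ S := delta_rpow_le_momentRatio hp2.le hV hn hL
  have hΛ0 : 0 ≤ Λ := L_nonneg ℱ _ _
  have hS0 : 0 < S := (Real.rpow_pos_of_pos hδ _).trans_le hδS
  have hB0 : 0 < S + Λ := by linarith
  have hsW : 0 < Real.sqrt W := Real.sqrt_pos.2 hV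
  -- This scale equates the Lindeberg error (S + Λ) ε^{2-p} with the smoothing error ε / √W.
  set ε := ((S + Λ) * Real.sqrt W) ^ (1 / (p - 1)) with hεdef
  have hε : 0 < ε := by positivity
  have hp1 : 0 < p - 1 := by linarith
  have hεp : ε ^ (p - 1) = (S + Λ) * Real.sqrt W := by
    rw [hεdef, ← Real.rpow_mul (by positivity), one_div_mul_cancel hp1.ne', Real.rpow_one]
  have hδW : δ ≤ Real.sqrt W := by
    obtain ⟨k, hk, hkδ⟩ := exists_sigma_eq_delta (ξ := ξ) (μ := μ) hn
    refine Real.le_sqrt_of_sq_le ?_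
    rw [hδdef, ← hkδ]
    exact sigma_sq_le_V hk
  have hδε : δ ≤ ε := by
    rw [← Real.rpow_le_rpow_iff hδ.le hε.le hp1, hεp, show p - 1 = p - 2 + 1 by ring,
      Real.rpow_add hδ, Real.rpow_one]
    exact mul_le_mul (by linarith) hδW hδ.le hB0.le
  have hscale : (S + Λ) * ε ^ (2 - p) = ε / Real.sqrt W := by
    rw [eq_div_iff hsW.ne', mul_right_comm, ← hεp, ← Real.rpow_add hε]
    norm_num
  have hVle : ∀ i, i ≤ n → 0 ≤ W - V ξ μ i := fun i hi ↦ sub_nonneg.2 (V_mono ξ μ hi)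
  -- the two error terms
  have herr1 : ∑ i ∈ Finset.range n, (∫ ω, |ξ (i + 1) ω| ^ p ∂μ) /
      (W - V ξ μ (i + 1) + ε ^ 2) ^ (p / 2) ≤ S * (A * ε ^ (2 - p)) := by
    have h1 := sum_div_rpow_le (n := n) (s := fun i ↦ W - V ξ μ i + ε ^ 2)
      (v := fun i ↦ sigma ξ μ (i + 1) ^ 2) hp2 hε (fun i ↦ sq_nonneg _)
      (fun i hi ↦ pow_le_pow_left₀ (sigma_nonneg ξ μ (i + 1)) ((sigma_le_delta
        (Finset.mem_Icc.2 ⟨by omega, by omega⟩)).trans hδε) 2)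
      (fun i ↦ by simp only [V_succ]; ring) (by simp [hW])
    refine le_trans ?_ (mul_le_mul_of_nonneg_left h1 hS0.le)
    rw [Finset.mul_sum]
    refine Finset.sum_le_sum fun i hi ↦ ?_
    have hi' := Finset.mem_range.1 hi
    rw [← mul_div_assoc]
    refine div_le_div_of_nonneg_right ?_ (Real.rpow_nonneg
      (add_nonneg (hVle (i + 1) (by omega)) (sq_nonneg _)) _)
    exact integral_rpow_le_momentRatio_mul hp2.le (Finset.mem_Icc.2 ⟨by omega, by omega⟩)
      (hL (i + 1) (by omega))
  have herr2 : ∑ i ∈ Finset.range j, U ξ ℱ μ n p (i + 2) /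
      (W - V ξ μ (i + 1) + ε ^ 2) ^ (p / 2) ≤ Λ * ε ^ (2 - p) := by
    rw [hΛ, L_succ_eq, Finset.sum_mul]
    refine Finset.sum_le_sum fun i hi ↦ ?_
    have hi' := Finset.mem_range.1 hi
    have hv := hVle (i + 1) (by omega)
    -- Split s^{p/2} = s · s^{(p-2)/2} with s = W - V_{i+1} + ε²: the first factor is at least the
    -- denominator in Λ since δ ≤ ε, the second at least ε^{p-2}.
    rw [show (p - (p - 2)) / 2 = 1 by ring, Real.rpow_one, show 2 - p = -(p - 2) by ring,
      Real.rpow_neg hε.le, ← div_eq_mul_inv, div_div]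
    have hδ2 : 0 < δ ^ 2 := by positivity
    have hε2 : 0 < ε ^ 2 := by positivity
    have hs : 0 < W - V ξ μ (i + 1) + ε ^ 2 := by linarith
    refine div_le_div_of_nonneg_left (U_nonneg ℱ _) (by positivity) ?_
    rw [show p / 2 = 1 + (p - 2) / 2 by ring, Real.rpow_add hs, Real.rpow_one]
    have h1 : ε ^ (p - 2) = (ε ^ 2) ^ ((p - 2) / 2) := by
      rw [← Real.rpow_natCast, ← Real.rpow_mul hε.le]
      congr 1; push_cast; ring
    rw [h1]
    have h2 : (ε ^ 2) ^ ((p - 2) / 2) ≤ (W - V ξ μ (i + 1) + ε ^ 2) ^ ((p - 2) / 2) :=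
      Real.rpow_le_rpow hε2.le (by linarith) (by linarith)
    have h3 : δ ^ 2 ≤ ε ^ 2 := pow_le_pow_left₀ hδ.le hδε 2
    gcongr
  have hlind : ∀ x, |∫ ω, heat (ε ^ 2) (x - partialSum ξ n ω) ∂μ - heat (W + ε ^ 2) x| ≤
      (18 * A + 5) * (ε / Real.sqrt W) := fun x ↦ by
    refine (abs_integral_heat_sub_le hξ hp2.le hp3 hL hε x j).trans ?_
    rw [← hscale]
    have h0 : 0 < ε ^ (2 - p) := by positivity
    calc _ ≤ 18 * (S * (A * ε ^ (2 - p))) + 9 / 2 * (Λ * ε ^ (2 - p)) := by gcongr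
      -- Padding, so that S and Λ get the same coefficient 18A + 5.
      _ ≤ 18 * (S * (A * ε ^ (2 - p))) + 9 / 2 * (Λ * ε ^ (2 - p)) +
          (18 * A * Λ + 5 * S + Λ / 2) * ε ^ (2 - p) := le_add_of_nonneg_right (by positivity)
      _ = _ := by ring
  -- unsmoothing
  have hmeas : Measurable fun ω ↦ partialSum ξ n ω / Real.sqrt W :=
    ((hξ.measurable_partialSum n).mono (ℱ.le n) le_rfl).div_const _
  have : IsProbabilityMeasure (μ.map fun ω ↦ partialSum ξ n ω / Real.sqrt W) :=
    Measure.isProbabilityMeasure_map hmeas.aemeasurable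
  -- Passing from variance W + ε² to W raises 18A + 5 to 18A + 6; then 2(18A + 6) + 10 is
  -- `kolmogorovConst p`.
  have hfinal := iSup_abs_cdf_sub_le (μ.map fun ω ↦ partialSum ξ n ω / Real.sqrt W)
    (ε := ε / Real.sqrt W) (R := (18 * A + 6) * (ε / Real.sqrt W)) (by positivity) fun w ↦ by
      have hc : Continuous fun z ↦ stdCDF ((w - z) / (ε / Real.sqrt W)) :=
        continuous_stdCDF.comp (by fun_prop)
      rw [integral_map hmeas.aemeasurable hc.aestronglyMeasurable]
      have h1 : ∀ ω, stdCDF ((w - partialSum ξ n ω / Real.sqrt W) / (ε / Real.sqrt W)) =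
          heat (ε ^ 2) (w * Real.sqrt W - partialSum ξ n ω) := fun ω ↦ by
        rw [heat, Real.sqrt_sq hε.le]
        congr 1
        field_simp
      have h2 : stdCDF w = heat W (w * Real.sqrt W) := by
        rw [heat, mul_div_cancel_right₀ _ hsW.ne']
      simp only [h1]
      rw [h2]
      have h3 := hlind (w * Real.sqrt W)
      have h4 := abs_heat_add_sub_le hV hε (w * Real.sqrt W)
      calc _ ≤ _ := abs_sub_le _ (heat (W + ε ^ 2) (w * Real.sqrt W)) _
        _ ≤ _ := add_le_add h3 h4
        _ = _ := by ring
  have hεW : ε / Real.sqrt W = W ^ (-((p - 2) / (2 * (p - 1)))) * (S + Λ) ^ (1 / (p - 1)) := by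
    rw [hεdef, Real.mul_rpow hB0.le hsW.le, mul_div_assoc, mul_comm]
    congr 1
    rw [Real.sqrt_eq_rpow, ← Real.rpow_mul hV.le, ← Real.rpow_sub hV]
    congr 1
    field_simp
    ring
  rw [← hεW]
  refine hfinal.trans_eq ?_
  rw [kolmogorovConst]; ring

/-! ### Constant conditional variances, and the logarithmic factor. -/

/-- By the tower property, a conditional variance constant given ℱ_{k-1} is the same constant given
the smaller ℱ_{ℓ-1}. -/
lemma L_eq_zero_of_constCondVar {μ : Measure Ω} [IsProbabilityMeasure μ] {ℱ : Filtration ℕ m}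
    {ξ : ℕ → Ω → ℝ} {n : ℕ} (h : ConstCondVar ξ ℱ μ n) (p r d : ℝ) : L ξ ℱ μ n p r d = 0 := by
  refine Finset.sum_eq_zero fun l hl ↦ ?_
  rw [Finset.mem_Icc] at hl
  have hk : ∀ k ∈ Finset.Icc l n,
      μ[fun ω' ↦ ξ k ω' ^ 2 | ℱ (l - 1)] =ᵐ[μ] fun _ ↦ sigma ξ μ k ^ 2 := fun k hk ↦ by
    rw [Finset.mem_Icc] at hk
    have h1 := condExp_condExp_of_le (μ := μ) (f := fun ω' ↦ ξ k ω' ^ 2)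
      (ℱ.mono (show l - 1 ≤ k - 1 by omega)) (ℱ.le (k - 1))
    have h2 := condExp_congr_ae (m := ℱ (l - 1)) (h k (Finset.mem_Icc.2 ⟨by omega, hk.2⟩))
    rw [condExp_const (ℱ.le _)] at h2
    exact h1.symm.trans h2
  have hall := (Finset.eventually_all (Finset.Icc l n)).2 hk
  have hU : U ξ ℱ μ n p l = 0 := by
    rw [U, integral_congr_ae (g := 0)]
    · simp
    · filter_upwards [hall] with ω hω
      rw [Finset.sum_eq_zero fun k hk ↦ sub_eq_zero.2 (hω k hk)]
      simp
  rw [hU, zero_div]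

/-- Since δ_n² ≤ V_n, v_n(1) ≥ 3δ_n², and log 3 ≥ 1. Thus the log-free bound at p = 3 implies the
one with the logarithm. -/
lemma half_le_log_sqrt_v_div_delta {μ : Measure Ω} {ξ : ℕ → Ω → ℝ} {n : ℕ} (hn : 1 ≤ n)
    (hV : 0 < V ξ μ n) : 1 / 2 ≤ Real.log (Real.sqrt (v ξ μ n 1) / delta ξ μ n) := by
  have hδ := delta_pos hV
  obtain ⟨k, hk, hkδ⟩ := exists_sigma_eq_delta (ξ := ξ) (μ := μ) hn
  have hδV : delta ξ μ n ^ 2 ≤ V ξ μ n := hkδ ▸ sigma_sq_le_V hk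
  have hv : 3 * delta ξ μ n ^ 2 ≤ v ξ μ n 1 := by
    rw [v]; norm_num; linarith
  have h1 : Real.sqrt 3 ≤ Real.sqrt (v ξ μ n 1) / delta ξ μ n := by
    rw [le_div_iff₀ hδ]
    refine Real.le_sqrt_of_sq_le ?_
    rw [mul_pow, Real.sq_sqrt (by norm_num)]
    exact hv
  have h2 : (1 : ℝ) ≤ Real.log 3 := by
    rw [Real.le_log_iff_exp_le (by norm_num)]
    linarith [Real.exp_one_lt_d9]
  calc (1 : ℝ) / 2 ≤ Real.log (Real.sqrt 3) := by rw [Real.log_sqrt (by norm_num)]; linarith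
    _ ≤ _ := Real.log_le_log (by positivity) h1

/-- The Kolmogorov bound in terms of the moment ratio for constant conditional variances. -/
lemma kolmogorovDist_le_of_constCondVar {μ : Measure Ω} [IsProbabilityMeasure μ]
    {ℱ : Filtration ℕ m} {ξ : ℕ → Ω → ℝ} {p K : ℝ} (hξ : IsMartingaleDifference ξ ℱ μ)
    (hp2 : 2 < p) (hp3 : p ≤ 3) (hL : ∀ k, 1 ≤ k → MemLp (ξ k) (ENNReal.ofReal p) μ) {n : ℕ}
    (hn : 1 ≤ n) (hV : 0 < V ξ μ n) (hK : momentRatio ξ μ n p ≤ K) (hc : ConstCondVar ξ ℱ μ n) :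
    kolmogorovDist ξ μ n ≤ kolmogorovConst p * max K 1 ^ (1 / (p - 1)) *
      V ξ μ n ^ (-((p - 2) / (2 * (p - 1)))) := by
  have h := kolmogorovDist_le hξ hp2 hp3 hL hn hV
  rw [L_eq_zero_of_constCondVar hc, add_zero] at h
  refine h.trans ?_
  have h1 : momentRatio ξ μ n p ^ (1 / (p - 1)) ≤ max K 1 ^ (1 / (p - 1)) :=
    Real.rpow_le_rpow momentRatio_nonneg (hK.trans (le_max_left _ _))
      (one_div_nonneg.2 (by linarith))
  have := kolmogorovConst_pos hp2
  rw [mul_assoc, mul_comm (max K 1 ^ _)]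
  gcongr

end MartingaleCLT

end

theorem corollary3p1 :
    -- the case `2 < p < 3`
    (∀ p : ℝ, 2 < p → p < 3 → ∃ C : ℝ, 0 < C ∧
      ∀ (Ω : Type u) (m : MeasurableSpace Ω) (μ : Measure Ω) [IsProbabilityMeasure μ]
        (ℱ : Filtration ℕ m) (ξ : ℕ → Ω → ℝ),
        MartingaleCLT.IsMartingaleDifference ξ ℱ μ →
        (∀ k, 1 ≤ k → MemLp (ξ k) (ENNReal.ofReal p) μ) →
        ∀ n : ℕ, 1 ≤ n → 0 < MartingaleCLT.V ξ μ n →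
          MartingaleCLT.kolmogorovDist ξ μ n ≤
            C * (MartingaleCLT.V ξ μ n ^ (-((p - 2) / (2 * (p - 1)))) *
              (MartingaleCLT.momentRatio ξ μ n p +
                MartingaleCLT.L ξ ℱ μ n p (p - 2) (MartingaleCLT.delta ξ μ n)) ^
                  (1 / (p - 1)))) ∧
    -- the case `p = 3`
    (∃ C : ℝ, 0 < C ∧
      ∀ (Ω : Type u) (m : MeasurableSpace Ω) (μ : Measure Ω) [IsProbabilityMeasure μ]
        (ℱ : Filtration ℕ m) (ξ : ℕ → Ω → ℝ),
        MartingaleCLT.IsMartingaleDifference ξ ℱ μ →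
        (∀ k, 1 ≤ k → MemLp (ξ k) 3 μ) →
        ∀ n : ℕ, 1 ≤ n → 0 < MartingaleCLT.V ξ μ n →
          MartingaleCLT.kolmogorovDist ξ μ n ≤
            C * (MartingaleCLT.V ξ μ n ^ (-(1 / 4 : ℝ)) *
              (MartingaleCLT.momentRatio ξ μ n 3 *
                  Real.log (Real.sqrt (MartingaleCLT.v ξ μ n 1) / MartingaleCLT.delta ξ μ n) +
                MartingaleCLT.L ξ ℱ μ n 3 1 (MartingaleCLT.delta ξ μ n)) ^ (1 / 2 : ℝ))) ∧
    -- constant conditional variances and comparable moments, `2 < p < 3`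
    (∀ p : ℝ, 2 < p → p < 3 → ∀ K : ℝ, ∃ C : ℝ, 0 < C ∧
      ∀ (Ω : Type u) (m : MeasurableSpace Ω) (μ : Measure Ω) [IsProbabilityMeasure μ]
        (ℱ : Filtration ℕ m) (ξ : ℕ → Ω → ℝ),
        MartingaleCLT.IsMartingaleDifference ξ ℱ μ →
        (∀ k, 1 ≤ k → MemLp (ξ k) (ENNReal.ofReal p) μ) →
        ∀ n : ℕ, 1 ≤ n → 0 < MartingaleCLT.V ξ μ n →
          MartingaleCLT.momentRatio ξ μ n p ≤ K → MartingaleCLT.ConstCondVar ξ ℱ μ n →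
          MartingaleCLT.kolmogorovDist ξ μ n ≤
            C * MartingaleCLT.V ξ μ n ^ (-((p - 2) / (2 * (p - 1))))) ∧
    -- constant conditional variances and comparable moments, `p = 3`
    (∀ K : ℝ, ∃ C : ℝ, 0 < C ∧
      ∀ (Ω : Type u) (m : MeasurableSpace Ω) (μ : Measure Ω) [IsProbabilityMeasure μ]
        (ℱ : Filtration ℕ m) (ξ : ℕ → Ω → ℝ),
        MartingaleCLT.IsMartingaleDifference ξ ℱ μ →
        (∀ k, 1 ≤ k → MemLp (ξ k) 3 μ) →
        ∀ n : ℕ, 1 ≤ n → 0 < MartingaleCLT.V ξ μ n →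
          MartingaleCLT.momentRatio ξ μ n 3 ≤ K → MartingaleCLT.ConstCondVar ξ ℱ μ n →
          MartingaleCLT.kolmogorovDist ξ μ n ≤
            C * (MartingaleCLT.V ξ μ n ^ (-(1 / 4 : ℝ)) *
              Real.log (Real.sqrt (MartingaleCLT.v ξ μ n 1) / MartingaleCLT.delta ξ μ n) ^
                (1 / 2 : ℝ))) := by
  -- At p = 3 the extra factor 2 pays for inserting the logarithm; `max K 1` keeps the constants
  -- positive for every K.
  refine ⟨fun p hp2 hp3 ↦ ⟨MartingaleCLT.kolmogorovConst p,
    MartingaleCLT.kolmogorovConst_pos hp2, ?_⟩,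
    ⟨2 * MartingaleCLT.kolmogorovConst 3, ?_, ?_⟩,
    fun p hp2 hp3 K ↦ ⟨MartingaleCLT.kolmogorovConst p * max K 1 ^ (1 / (p - 1)), ?_, ?_⟩,
    fun K ↦ ⟨2 * (MartingaleCLT.kolmogorovConst 3 * max K 1 ^ (1 / ((3 : ℝ) - 1))), ?_, ?_⟩⟩
  · intro Ω m μ _ ℱ ξ hξ hL n hn hV
    exact MartingaleCLT.kolmogorovDist_le hξ hp2 hp3.le hL hn hV
  · have := MartingaleCLT.kolmogorovConst_pos (p := 3) (by norm_num)
    positivity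
  · intro Ω m μ _ ℱ ξ hξ hL n hn hV
    have h := MartingaleCLT.kolmogorovDist_le hξ (p := 3) (by norm_num) le_rfl
      (by simpa only [ENNReal.ofReal_ofNat] using hL) hn hV
    rw [show (3 : ℝ) - 2 = 1 by norm_num, show -((1 : ℝ) / (2 * (3 - 1))) = -(1 / 4) by norm_num,
      show (1 : ℝ) / (3 - 1) = 1 / 2 by norm_num] at h
    have hlog := MartingaleCLT.half_le_log_sqrt_v_div_delta hn hV
    have hC := MartingaleCLT.kolmogorovConst_pos (p := 3) (by norm_num)
    have hS := MartingaleCLT.momentRatio_nonneg (ξ := ξ) (μ := μ) (n := n) (p := 3)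
    have hL0 := MartingaleCLT.L_nonneg (ξ := ξ) (μ := μ) (n := n) (p := 3) ℱ 1
      (MartingaleCLT.delta ξ μ n)
    set S := MartingaleCLT.momentRatio ξ μ n 3
    set Λ := MartingaleCLT.L ξ ℱ μ n 3 1 (MartingaleCLT.delta ξ μ n)
    set l := Real.log (Real.sqrt (MartingaleCLT.v ξ μ n 1) / MartingaleCLT.delta ξ μ n)
    -- From l ≥ 1/2, S + Λ ≤ 4(S l + Λ).
    have h1 : (S + Λ) ^ (1 / 2 : ℝ) ≤ 2 * (S * l + Λ) ^ (1 / 2 : ℝ) := by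
      have h2 : (2 : ℝ) = (4 : ℝ) ^ (1 / 2 : ℝ) := by
        rw [← Real.sqrt_eq_rpow, show (4 : ℝ) = 2 ^ 2 by norm_num, Real.sqrt_sq zero_le_two]
      nth_rewrite 2 [h2]
      rw [← Real.mul_rpow (by norm_num) (by positivity)]
      exact Real.rpow_le_rpow (by positivity) (by nlinarith) (by norm_num)
    refine h.trans ?_
    have hV0 : 0 ≤ MartingaleCLT.V ξ μ n ^ (-(1 / 4 : ℝ)) := Real.rpow_nonneg hV.le _
    calc _ ≤ MartingaleCLT.kolmogorovConst 3 * (MartingaleCLT.V ξ μ n ^ (-(1 / 4 : ℝ)) *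
          (2 * (S * l + Λ) ^ (1 / 2 : ℝ))) := by gcongr
      _ = _ := by ring
  · have := MartingaleCLT.kolmogorovConst_pos hp2
    positivity
  · intro Ω m μ _ ℱ ξ hξ hL n hn hV hK hc
    exact MartingaleCLT.kolmogorovDist_le_of_constCondVar hξ hp2 hp3.le hL hn hV hK hc
  · have := MartingaleCLT.kolmogorovConst_pos (p := 3) (by norm_num)
    positivity
  · intro Ω m μ _ ℱ ξ hξ hL n hn hV hK hc
    have h := MartingaleCLT.kolmogorovDist_le_of_constCondVar hξ (p := 3) (by norm_num) le_rfl
      (by simpa only [ENNReal.ofReal_ofNat] using hL) hn hV hK hc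
    rw [show -(((3 : ℝ) - 2) / (2 * (3 - 1))) = -(1 / 4) by norm_num] at h
    have hlog := MartingaleCLT.half_le_log_sqrt_v_div_delta hn hV
    have hC := MartingaleCLT.kolmogorovConst_pos (p := 3) (by norm_num)
    set l := Real.log (Real.sqrt (MartingaleCLT.v ξ μ n 1) / MartingaleCLT.delta ξ μ n)
    have h1 : 1 ≤ 2 * l ^ (1 / 2 : ℝ) := by
      rw [← Real.sqrt_eq_rpow]
      have : (1 / 2 : ℝ) ≤ Real.sqrt l := Real.le_sqrt_of_sq_le (by linarith)
      linarith
    have hV0 : 0 ≤ MartingaleCLT.V ξ μ n ^ (-(1 / 4 : ℝ)) := Real.rpow_nonneg hV.le _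
    have hK0 : 0 ≤ MartingaleCLT.kolmogorovConst 3 * max K 1 ^ (1 / ((3 : ℝ) - 1)) := by positivity
    refine h.trans ((le_mul_of_one_le_right (mul_nonneg hK0 hV0) h1).trans_eq ?_)
    ring
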